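/- **Setting.** Let $\mathcal S_1,\mathcal S_2,\mathcal X,\mathcal Y_1,\mathcal Y_2$ be finite sets with $\mathcal X\ne\emptyset$, let $p_{(S_1,S_2)}$ be a probability distribution on $\mathcal S_1\times\mathcal S_2$, let $p_{Y_1,Y_2|X}$ be a discrete memoryless broadcast channel with input alphabet $\mathcal X$ and output alphabets $\mathcal Y_1,\mathcal Y_2$, and let $\kappa\ge 0$. Let $(S_1(t),S_2(t))$, $t=1,2,\dots$, be i.i.d. with law $p_{(S_1,S_2)}$. We say that $p_{(S_1,S_2)}$ is *admissible* for $p_{Y_1,Y_2|X}$ subject to bandwidth expansion constraint $\kappa$ if for every $\epsilon>0$ there are integers $m\ge 1$ and $n\ge 0$ with $n/m\le\kappa+\epsilon$, an encoding function $f:\mathcal S_1^m\times\mathcal S_2^m\to\mathcal X^n$ and decoding functions $g_i:\mathcal Y_i^n\to\mathcal S_i^m$, $i=1,2$, such that, when $X^n=f(S_1^m,S_2^m)$ is sent over the channel and $\hat S_i^m=g_i(Y_i^n)$, $$\frac1m\sum_{t=1}^m\Pr(S_i(t)\ne\hat S_i(t))\le\epsilon,\qquad i=1,2.$$ For an input distribution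 $p_X$ on $\mathcal X$, a conditional distribution $p_{U|(S_1,S_2)}$ and a conditional distribution $p_{V_0,V_1,V_2|X}$ (with finite alphabets $\mathcal U,\mathcal V_0,\mathcal V_1,\mathcal V_2$), consider $(U,S_1,S_2)\sim p_{U|(S_1,S_2)}p_{(S_1,S_2)}$ and $(V_0,V_1,V_2,X,Y_1,Y_2)\sim p_{V_0,V_1,V_2|X}\,p_X\,p_{Y_1,Y_2|X}$ and the inequalities $$\begin{aligned} &I(U;S_i)\le\kappa I(V_0;Y_i),\quad i=1,2,\\ &H(S_i)\le\kappa I(V_0,V_i;Y_i),\quad i=1,2,\\ &I(U;S_1)+H(S_2|U)\le\kappa[I(V_0;Y_1)+I(V_2;Y_2|V_0)],\\ &I(U;S_2)+H(S_1|U)\le\kappa[I(V_0;Y_2)+I(V_1;Y_1|V_0)],\\ &I(U;S_1)+H(S_1,S_2|U)\le\kappa[I(V_0,V_1;Y_1)+I(X;Y_2|V_0,V_1)],\\ &I(U;S_2)+H(S_1,S_2|U)\le\kappa[I(V_0,V_2;Y_2)+I(X;Y_1|V_0,V_2)],\\ &I(U;S_1)+H(S_1,S_2|U)\le\kappa[I(V_0;Y_1)+I(V_2;Y_2|V_0)+I(X;Y_1|V_0,V_2)],\\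 &I(U;S_2)+H(S_1,S_2|U)\le\kappa[I(V_0;Y_2)+I(V_1;Y_1|V_0)+I(X;Y_2|V_0,V_1)]. \end{aligned}\tag{$*$}$$ **Theorem.** 1. If $p_{(S_1,S_2)}$ is admissible for $p_{Y_1,Y_2|X}$ subject to bandwidth expansion constraint $\kappa$, then there is an input distribution $p_X$ such that for every finite $\mathcal U$ and every $p_{U|(S_1,S_2)}$ there is a $p_{V_0,V_1,V_2|X}$ satisfying $(*)$, with $|\mathcal V_0|\le|\mathcal X|+5$ and $|\mathcal V_i|\le|\mathcal X|$, $i=1,2$. 2. In this condition it suffices to consider $|\mathcal U|\le|\mathcal S_1|\,|\mathcal S_2|$, $|\mathcal V_0|\le|\mathcal X|+5$ and $|\mathcal V_i|\le|\mathcal X|$: for every $p_X$ (whether or not the source is admissible), if for every $p_{U|(S_1,S_2)}$ with $|\mathcal U|\le|\mathcal S_1|\,|\mathcal S_2|$ there is some $p_{V_0,V_1,V_2|X}$ with arbitrary finite alphabets satisfying $(*)$, then for every $p_{U|(S_1,S_2)}$ with arbitrary finite $\mathcal U$ there is such a $p_{V_0,V_1,V_2|X}$ with $|\mathcal V_0|\le|\mathcal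 X|+5$ and $|\mathcal V_i|\le|\mathcal X|$, $i=1,2$. 3. Let $S_0$ be the common part of $S_1$ and $S_2$ in the sense of Gács–Körner and Witsenhausen, i.e. $S_0=\varphi_1(S_1)=\varphi_2(S_2)$ almost surely and every random variable that is almost surely both a function of $S_1$ and a function of $S_2$ is almost surely a function of $S_0$. Then for all $p_X$ and $p_{V_0,V_1,V_2|X}$ the inequalities $(*)$ with $U=S_0$ hold if and only if the inequalities of the Gohari–Anantharam outer bound hold, namely, with $\mu=\min\{I(V_0;Y_1),I(V_0;Y_2)\}$, $$\begin{aligned} &H(S_0)\le\kappa\mu,\qquad H(S_i)\le\kappa[\mu+I(V_i;Y_i|V_0)],\quad i=1,2,\\ &H(S_1,S_2)\le\kappa[\mu+I(V_1;Y_1|V_0)+I(X;Y_2|V_0,V_1)],\\ &H(S_1,S_2)\le\kappa[\mu+I(V_2;Y_2|V_0)+I(X;Y_1|V_0,V_2)]. \end{aligned}$$ -/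

import Mathlib

open scoped BigOperators

noncomputable section

namespace BroadcastSource

/-! ### Shannon information measures of random variables on a finite probability space -/

section Information

variable {Ω α β γ : Type*}

/-- The probability `Pr(A = a)` under the law `P`. -/
def prob (P : PMF Ω) (A : Ω → α) (a : α) : ℝ := (P.map A a).toReal

/-- The joint random variable `(A, B)`. -/
def pair (A : Ω → α) (B : Ω → β) : Ω → α × β := fun ω => (A ω, B ω)

/-- The Shannon entropy `H(A)`, in nats. -/
def entropy [Fintype α] (P : PMF Ω) (A : Ω → α) : ℝ :=
  ∑ a, Real.negMulLog (prob P A a)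

/-- The conditional entropy `H(A | B) = ∑ b, Pr(B = b) H(A | B = b)`. -/
def condEntropy [Fintype α] [Fintype β] (P : PMF Ω) (A : Ω → α) (B : Ω → β) : ℝ :=
  ∑ b, prob P B b * ∑ a, Real.negMulLog (prob P (pair A B) (a, b) / prob P B b)

/-- The mutual information `I(A; B) = H(A) - H(A | B)`. -/
def mutualInfo [Fintype α] [Fintype β] (P : PMF Ω) (A : Ω → α) (B : Ω → β) : ℝ :=
  entropy P A - condEntropy P A B

/-- The conditional mutual information `I(A; B | C) = H(A | C) - H(A | B, C)`. -/
def condMutualInfo [Fintype α] [Fintype β] [Fintype γ] (P : PMF Ω)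
    (A : Ω → α) (B : Ω → β) (C : Ω → γ) : ℝ :=
  condEntropy P A C - condEntropy P A (pair B C)

end Information

/-! ### Block codes and admissibility -/

section Coding

/-- The law of independent random variables `A(1), …, A(n)` with `A(t)` distributed as `q t`. -/
def productPMF {α : Type*} [Fintype α] {n : ℕ} (q : Fin n → PMF α) : PMF (Fin n → α) :=
  PMF.ofFintype (fun a => ∏ t, q t (a t)) (by
    have h : ∀ t, ∑ a, q t a = 1 := fun t => by
      rw [← (q t).tsum_coe, tsum_fintype]
    classical
    rw [← Fintype.prod_sum (fun t a => q t a)]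
    simp [h])

variable {S₁ S₂ X Y₁ Y₂ : Type*} [Fintype S₁] [Fintype S₂] [Fintype Y₁] [Fintype Y₂]

/-- The joint law of an i.i.d. source block of length `m` and of the output block that results when
its encoding `f` is sent over the memoryless broadcast channel `W`. -/
def blockLaw (p : PMF (S₁ × S₂)) (W : X → PMF (Y₁ × Y₂)) {m n : ℕ}
    (f : (Fin m → S₁) × (Fin m → S₂) → (Fin n → X)) :
    PMF ((Fin m → S₁ × S₂) × (Fin n → Y₁ × Y₂)) :=
  (productPMF fun _ : Fin m => p).bind fun s =>
    (productPMF fun q : Fin n => W (f (fun t => (s t).1, fun t => (s t).2) q)).map fun y => (s, y)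

/-- `p` is admissible for the broadcast channel `W` subject to bandwidth expansion constraint `κ`:
for every `ε > 0` there are a code with source block length `m ≥ 1` and channel block length
`n = ρ m`, `ρ ≤ κ + ε`, whose average symbol error probability is at most `ε` at both receivers. -/
def Admissible (p : PMF (S₁ × S₂)) (W : X → PMF (Y₁ × Y₂)) (κ : ℝ) : Prop :=
  ∀ ε : ℝ, 0 < ε → ∃ (m n : ℕ) (f : (Fin m → S₁) × (Fin m → S₂) → (Fin n → X))
    (g₁ : (Fin n → Y₁) → (Fin m → S₁)) (g₂ : (Fin n → Y₂) → (Fin m → S₂)),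
    0 < m ∧ (n : ℝ) / m ≤ κ + ε ∧
    (1 / (m : ℝ)) * ∑ t : Fin m, ((blockLaw p W f).toOuterMeasure
      {ω | (ω.1 t).1 ≠ g₁ (fun q => (ω.2 q).1) t}).toReal ≤ ε ∧
    (1 / (m : ℝ)) * ∑ t : Fin m, ((blockLaw p W f).toOuterMeasure
      {ω | (ω.1 t).2 ≠ g₂ (fun q => (ω.2 q).2) t}).toReal ≤ ε

end Coding

/-! ### Test distributions and the inequalities of the outer bounds -/

section Bounds

variable {Ω Ω' U S₁ S₂ V₀ V₁ V₂ X Y₁ Y₂ T : Type*} [Fintype U] [Fintype S₁] [Fintype S₂]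
  [Fintype V₀] [Fintype V₁] [Fintype V₂] [Fintype X] [Fintype Y₁] [Fintype Y₂] [Fintype T]

/-- The joint law `p_{U|(S₁,S₂)} p_{(S₁,S₂)}` of `(U, S₁, S₂)`. -/
def sourceJoint {U S₁ S₂ : Type*} (p : PMF (S₁ × S₂)) (pU : S₁ × S₂ → PMF U) :
    PMF (U × S₁ × S₂) :=
  p.bind fun s => (pU s).map fun u => (u, s)

/-- The joint law `p_{V₀,V₁,V₂|X} p_X p_{Y₁,Y₂|X}` of `(V₀, V₁, V₂, X, Y₁, Y₂)`. -/
def channelJoint {V₀ V₁ V₂ X Y₁ Y₂ : Type*} (pX : PMF X) (pV : X → PMF (V₀ × V₁ × V₂))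
    (W : X → PMF (Y₁ × Y₂)) : PMF ((V₀ × V₁ × V₂) × X × Y₁ × Y₂) :=
  pX.bind fun x => (pV x).bind fun v => (W x).map fun y => (v, x, y)

/-- The comparison of the measurements of `(U, S₁, S₂)` under `P` with those of
`(V₀, V₁, V₂, X, Y₁, Y₂)` under `Q`. -/
structure Dominated (κ : ℝ) (P : PMF Ω) (u : Ω → U) (s₁ : Ω → S₁) (s₂ : Ω → S₂)
    (Q : PMF Ω') (v₀ : Ω' → V₀) (v₁ : Ω' → V₁) (v₂ : Ω' → V₂) (x : Ω' → X)
    (y₁ : Ω' → Y₁) (y₂ : Ω' → Y₂) : Prop where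
  common₁ : mutualInfo P u s₁ ≤ κ * mutualInfo Q v₀ y₁
  common₂ : mutualInfo P u s₂ ≤ κ * mutualInfo Q v₀ y₂
  single₁ : entropy P s₁ ≤ κ * mutualInfo Q (pair v₀ v₁) y₁
  single₂ : entropy P s₂ ≤ κ * mutualInfo Q (pair v₀ v₂) y₂
  cross₁ : mutualInfo P u s₁ + condEntropy P s₂ u ≤
    κ * (mutualInfo Q v₀ y₁ + condMutualInfo Q v₂ y₂ v₀)
  cross₂ : mutualInfo P u s₂ + condEntropy P s₁ u ≤
    κ * (mutualInfo Q v₀ y₂ + condMutualInfo Q v₁ y₁ v₀)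
  total₁ : mutualInfo P u s₁ + condEntropy P (pair s₁ s₂) u ≤
    κ * (mutualInfo Q (pair v₀ v₁) y₁ + condMutualInfo Q x y₂ (pair v₀ v₁))
  total₂ : mutualInfo P u s₂ + condEntropy P (pair s₁ s₂) u ≤
    κ * (mutualInfo Q (pair v₀ v₂) y₂ + condMutualInfo Q x y₁ (pair v₀ v₂))
  chain₁ : mutualInfo P u s₁ + condEntropy P (pair s₁ s₂) u ≤
    κ * (mutualInfo Q v₀ y₁ + condMutualInfo Q v₂ y₂ v₀ + condMutualInfo Q x y₁ (pair v₀ v₂))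
  chain₂ : mutualInfo P u s₂ + condEntropy P (pair s₁ s₂) u ≤
    κ * (mutualInfo Q v₀ y₂ + condMutualInfo Q v₁ y₁ v₀ + condMutualInfo Q x y₂ (pair v₀ v₁))

/-- The inequalities of the outer bound, for the test distributions `pU` and `pV`. -/
def BoundHolds (κ : ℝ) (p : PMF (S₁ × S₂)) (W : X → PMF (Y₁ × Y₂)) (pX : PMF X)
    (pU : S₁ × S₂ → PMF U) (pV : X → PMF (V₀ × V₁ × V₂)) : Prop :=
  Dominated κ (sourceJoint p pU) (fun ω => ω.1) (fun ω => ω.2.1) (fun ω => ω.2.2)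
    (channelJoint pX pV W) (fun ω => ω.1.1) (fun ω => ω.1.2.1) (fun ω => ω.1.2.2)
    (fun ω => ω.2.1) (fun ω => ω.2.2.1) (fun ω => ω.2.2.2)

/-- `φ₁(S₁) = φ₂(S₂)` almost surely, and every random variable that is almost surely both a function
of `S₁` and a function of `S₂` is almost surely a function of it: `φ₁(S₁)` is the common part of
`S₁` and `S₂` in the sense of Gács–Körner and Witsenhausen. (The test functions may be taken with
values in `ℕ` because the alphabets are finite.) -/
structure IsCommonPart {S₁ S₂ T : Type*} (p : PMF (S₁ × S₂)) (φ₁ : S₁ → T) (φ₂ : S₂ → T) :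
    Prop where
  agree : ∀ s ∈ p.support, φ₁ s.1 = φ₂ s.2
  maximal : ∀ (ψ₁ : S₁ → ℕ) (ψ₂ : S₂ → ℕ), (∀ s ∈ p.support, ψ₁ s.1 = ψ₂ s.2) →
    ∃ h : T → ℕ, ∀ s ∈ p.support, ψ₁ s.1 = h (φ₁ s.1)

/-- The inequalities of the Gohari–Anantharam outer bound, for a common part `s₀`. -/
structure GohariAnantharam (κ : ℝ) (P : PMF Ω) (s₀ : Ω → T) (s₁ : Ω → S₁) (s₂ : Ω → S₂)
    (Q : PMF Ω') (v₀ : Ω' → V₀) (v₁ : Ω' → V₁) (v₂ : Ω' → V₂) (x : Ω' → X)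
    (y₁ : Ω' → Y₁) (y₂ : Ω' → Y₂) : Prop where
  common : entropy P s₀ ≤ κ * min (mutualInfo Q v₀ y₁) (mutualInfo Q v₀ y₂)
  single₁ : entropy P s₁ ≤
    κ * (min (mutualInfo Q v₀ y₁) (mutualInfo Q v₀ y₂) + condMutualInfo Q v₁ y₁ v₀)
  single₂ : entropy P s₂ ≤
    κ * (min (mutualInfo Q v₀ y₁) (mutualInfo Q v₀ y₂) + condMutualInfo Q v₂ y₂ v₀)
  total₁ : entropy P (pair s₁ s₂) ≤
    κ * (min (mutualInfo Q v₀ y₁) (mutualInfo Q v₀ y₂) + condMutualInfo Q v₁ y₁ v₀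
      + condMutualInfo Q x y₂ (pair v₀ v₁))
  total₂ : entropy P (pair s₁ s₂) ≤
    κ * (min (mutualInfo Q v₀ y₁) (mutualInfo Q v₀ y₂) + condMutualInfo Q v₂ y₂ v₀
      + condMutualInfo Q x y₁ (pair v₀ v₂))

/-- The Gohari–Anantharam inequalities for the source `p`, with common part `φ₁(S₁)`, and the
test distribution `pV`. -/
def GohariAnantharamHolds (κ : ℝ) (p : PMF (S₁ × S₂)) (W : X → PMF (Y₁ × Y₂)) (pX : PMF X)
    (φ₁ : S₁ → T) (pV : X → PMF (V₀ × V₁ × V₂)) : Prop :=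
  GohariAnantharam κ p (fun s => φ₁ s.1) (fun s => s.1) (fun s => s.2)
    (channelJoint pX pV W) (fun ω => ω.1.1) (fun ω => ω.1.2.1) (fun ω => ω.1.2.2)
    (fun ω => ω.2.1) (fun ω => ω.2.2.1) (fun ω => ω.2.2.2)

end Bounds

end BroadcastSource

end

universe w

open BroadcastSource

/-!
*Outer bound.* A code for source blocks of length `m` is single-letterized with
`V₀(t) = (Uᵐ, Y₁ before t, Y₂ after t)` and `Vᵢ(t) = Sᵢᵐ`: Csiszár's sum identity makes the mixed
past/future terms cancel, and Fano's inequality gives the bound up to an error that vanishes with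
`ε`. Averaging over `t` preserves the inequalities because a time-sharing variable can be absorbed
in `V₀` and mutual information is concave in the input law. The limiting input law is extracted
from the codes alone, by compactness, so that it does not depend on `U`.

*Alphabets.* Given `V₀ = v`, the auxiliary `Vᵢ` enters only through an average of output entropies,
so it may be replaced by a splitting of the input law into at most `|X|` parts (Carathéodory).
The right-hand sides of the ten inequalities are thus linear in a conic combination of such
splittings. Fixing `|X| + 5` linear functionals of it while optimizing one more, an extreme point
uses at most `|X| + 5` letters of `V₀`. On the source side, the entropies given `U` are a convex
combination of those attained with `|U| ≤ |S₁| |S₂|`, and the attainable right-hand sides form a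
convex set.

*Common part.* If `U = φ₁(S₁) = φ₂(S₂)` almost surely, then `I(U; Sᵢ) = H(U)` and
`H(Sᵢ) = H(U) + H(Sᵢ | U)`, after which the two systems of inequalities differ by linear algebra.
-/

noncomputable section

namespace BroadcastSource

open scoped Classical Topology Pointwise
open Real Filter Function

section Probability

variable {Ω α β : Type*} (P : PMF Ω) (A : Ω → α) (B : Ω → β)

lemma prob_nonneg (a : α) : 0 ≤ prob P A a := ENNReal.toReal_nonneg

lemma prob_id (p : PMF α) (a : α) : prob p (fun x => x) a = (p a).toReal :=
  congrArg (fun q : PMF α => (q a).toReal) p.map_id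

lemma prob_map (F : Ω → α) (G : α → β) (b : β) :
    prob (P.map F) G b = prob P (fun ω => G (F ω)) b := by
  rw [prob, PMF.map_comp]
  rfl

lemma sum_toReal_pmf [Fintype α] (p : PMF α) : ∑ a, (p a).toReal = 1 := by
  rw [← ENNReal.toReal_sum fun a _ => p.apply_ne_top a,
    ← tsum_fintype (L := .unconditional _), p.tsum_coe, ENNReal.toReal_one]

lemma sum_prob [Fintype α] : ∑ a, prob P A a = 1 := sum_toReal_pmf _

variable {A} in
lemma prob_eq_one [Fintype α] [Subsingleton α] (a : α) : prob P A a = 1 := by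
  rw [← sum_prob P A, Fintype.sum_subsingleton _ a]

lemma prob_comp [Fintype α] (φ : α → β) (b : β) :
    prob P (fun ω => φ (A ω)) b = ∑ a, if φ a = b then prob P A a else 0 := by
  rw [← prob_map P A φ, prob, PMF.map_apply, tsum_fintype, ENNReal.toReal_sum fun a _ => ?_]
  · simp only [eq_comm (a := b), apply_ite ENNReal.toReal, ENNReal.toReal_zero, prob]
  · split_ifs
    exacts [(P.map A).apply_ne_top a, ENNReal.zero_ne_top]

lemma sum_prob_comp [Fintype α] [Fintype β] (φ : α → β) (F : β → ℝ) :
    ∑ b, prob P (fun ω => φ (A ω)) b * F b = ∑ a, prob P A a * F (φ a) := by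
  simp_rw [prob_comp P A φ, Finset.sum_mul, ite_mul, zero_mul]
  rw [Finset.sum_comm]
  simp

lemma prob_le_prob_comp (φ : α → β) (a : α) :
    prob P A a ≤ prob P (fun ω => φ (A ω)) (φ a) := by
  refine ENNReal.toReal_mono (PMF.apply_ne_top _ _) ?_
  rw [PMF.map_apply, PMF.map_apply]
  refine ENNReal.tsum_le_tsum fun ω => ?_
  by_cases hω : a = A ω <;> simp [hω]

lemma prob_pair_le_snd (a : α) (b : β) : prob P (pair A B) (a, b) ≤ prob P B b :=
  prob_le_prob_comp P (pair A B) Prod.snd (a, b)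

variable [Fintype α] [Fintype β]

lemma prob_snd_eq_sum (b : β) : prob P B b = ∑ a, prob P (pair A B) (a, b) := by
  have h := prob_comp P (pair A B) Prod.snd b
  simp only [Fintype.sum_prod_type, Finset.sum_ite_eq', Finset.mem_univ, if_true] at h
  exact h

lemma prob_fst_eq_sum (a : α) : prob P A a = ∑ b, prob P (pair A B) (a, b) := by
  have h := prob_comp P (pair A B) Prod.fst a
  simp only [Fintype.sum_prod_type_right, Finset.sum_ite_eq', Finset.mem_univ, if_true] at h
  exact h

end Probability

section Entropy

variable {Ω α β γ δ : Type*} [Fintype α] [Fintype β] [Fintype γ] [Fintype δ]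
  (P : PMF Ω) (A : Ω → α) (B : Ω → β) (C : Ω → γ)

lemma mul_negMulLog_div (c x : ℝ) (h : c = 0 → x = 0) :
    c * negMulLog (x / c) = negMulLog x + x * log c := by
  rcases eq_or_ne c 0 with hc | hc
  · simp [hc, h hc]
  rcases eq_or_ne x 0 with hx | hx
  · simp [hx]
  · rw [negMulLog, negMulLog, log_div hx hc]
    field_simp
    ring

lemma condEntropy_eq : condEntropy P A B = entropy P (pair A B) - entropy P B := by
  have hterm (a : α) (b : β) : prob P B b * negMulLog (prob P (pair A B) (a, b) / prob P B b) =
      negMulLog (prob P (pair A B) (a, b)) + prob P (pair A B) (a, b) * log (prob P B b) :=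
    mul_negMulLog_div _ _ fun h0 =>
      le_antisymm (h0 ▸ prob_pair_le_snd P A B a b) (prob_nonneg _ _ _)
  simp only [condEntropy, entropy, Fintype.sum_prod_type_right, ← Finset.sum_sub_distrib]
  refine Finset.sum_congr rfl fun b _ => ?_
  rw [Finset.mul_sum, Finset.sum_congr rfl fun a _ => hterm a b, Finset.sum_add_distrib,
    ← Finset.sum_mul, ← prob_snd_eq_sum P A B b, negMulLog]
  ring

lemma entropy_comp_eq_sum (φ : α → β) :
    entropy P (fun ω => φ (A ω)) =
      ∑ a, prob P A a * -log (prob P (fun ω => φ (A ω)) (φ a)) := by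
  rw [← sum_prob_comp P A φ fun b => -log (prob P (fun ω => φ (A ω)) b)]
  simp [entropy, negMulLog]

lemma entropy_eq_sum : entropy P A = ∑ a, prob P A a * -log (prob P A a) :=
  entropy_comp_eq_sum P A id

lemma mul_log_sub_log_le {p q : ℝ} (hp : 0 ≤ p) (hq : 0 ≤ q) (h : q = 0 → p = 0) :
    p * (log q - log p) ≤ q - p := by
  rcases hp.eq_or_lt with rfl | hp
  · simpa using hq
  have hq : 0 < q := hq.lt_of_ne' fun h0 => hp.ne' (h h0)
  calc p * (log q - log p) = p * log (q / p) := by rw [log_div hq.ne' hp.ne']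
    _ ≤ p * (q / p - 1) := by gcongr; exact log_le_sub_one_of_pos (div_pos hq hp)
    _ = q - p := by field_simp

lemma sum_mul_neg_log_le_sum_mul_neg_log {p q : α → ℝ} (hp : ∀ a, 0 ≤ p a) (hq : ∀ a, 0 ≤ q a)
    (hpq : ∀ a, q a = 0 → p a = 0) (hsum : ∑ a, q a ≤ ∑ a, p a) :
    ∑ a, p a * -log (p a) ≤ ∑ a, p a * -log (q a) := by
  rw [← sub_nonpos, ← Finset.sum_sub_distrib]
  calc ∑ a, (p a * -log (p a) - p a * -log (q a))
      ≤ ∑ a, (q a - p a) := Finset.sum_le_sum fun a _ =>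
        (by ring : p a * -log (p a) - p a * -log (q a) = p a * (log (q a) - log (p a))).trans_le
          (mul_log_sub_log_le (hp a) (hq a) (hpq a))
    _ ≤ 0 := by rw [Finset.sum_sub_distrib]; linarith

lemma condEntropy_le_crossEntropy (q : β → α → ℝ) (hq : ∀ b a, 0 ≤ q b a)
    (hq_sum : ∀ b, ∑ a, q b a ≤ 1) (hpos : ∀ a b, q b a = 0 → prob P (pair A B) (a, b) = 0) :
    condEntropy P A B ≤ ∑ x, prob P (pair A B) x * -log (q x.2 x.1) := by
  have hGibbs : entropy P (pair A B) ≤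
      ∑ x, prob P (pair A B) x * -log (prob P B x.2 * q x.2 x.1) := by
    rw [entropy_eq_sum]
    refine sum_mul_neg_log_le_sum_mul_neg_log (prob_nonneg _ _)
      (fun x => mul_nonneg (prob_nonneg _ _ _) (hq _ _)) (fun x hx => ?_) ?_
    · rcases mul_eq_zero.1 hx with hB | hq0
      · exact le_antisymm (hB ▸ prob_pair_le_snd P A B x.1 x.2) (prob_nonneg _ _ _)
      · exact hpos _ _ hq0
    · rw [sum_prob, ← sum_prob P B, Fintype.sum_prod_type_right]
      refine Finset.sum_le_sum fun b _ => ?_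
      simp only [← Finset.mul_sum]
      exact mul_le_of_le_one_right (prob_nonneg _ _ _) (hq_sum b)
  have hB : entropy P B = ∑ x, prob P (pair A B) x * -log (prob P B x.2) :=
    entropy_comp_eq_sum P (pair A B) Prod.snd
  rw [condEntropy_eq, sub_le_iff_le_add, hB, ← Finset.sum_add_distrib]
  refine hGibbs.trans_eq (Finset.sum_congr rfl fun x _ => ?_)
  rcases eq_or_ne (prob P (pair A B) x) 0 with h0 | h0
  · simp [h0]
  rw [log_mul (fun hB => h0 (le_antisymm (hB ▸ prob_pair_le_snd P A B x.1 x.2)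
    (prob_nonneg _ _ _))) fun hq0 => h0 (hpos _ _ hq0)]
  ring

lemma condEntropy_comp_eq_sum (φ : β → γ) :
    condEntropy P A (fun ω => φ (B ω)) = ∑ x, prob P (pair A B) x *
      -log (prob P (pair A fun ω => φ (B ω)) (x.1, φ x.2) / prob P (fun ω => φ (B ω)) (φ x.2)) := by
  have hpair : entropy P (pair A fun ω => φ (B ω)) = _ :=
    entropy_comp_eq_sum P (pair A B) fun x => (x.1, φ x.2)
  have hcond : entropy P (fun ω => φ (B ω)) = _ :=
    entropy_comp_eq_sum P (pair A B) fun x => φ x.2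
  rw [condEntropy_eq, hpair, hcond, ← Finset.sum_sub_distrib]
  refine Finset.sum_congr rfl fun x _ => ?_
  rcases (prob_nonneg P (pair A B) x).eq_or_lt with h0 | hpos
  · simp [← h0]
  have hle : prob P (pair A B) x ≤ prob P (pair A fun ω => φ (B ω)) (x.1, φ x.2) :=
    prob_le_prob_comp P (pair A B) (fun x => (x.1, φ x.2)) x
  have hle' := prob_pair_le_snd P A (fun ω => φ (B ω)) x.1 (φ x.2)
  rw [log_div (hpos.trans_le hle).ne' (hpos.trans_le (hle.trans hle')).ne']
  change _ * -log (prob P (pair A fun ω => φ (B ω)) _) -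
    _ * -log (prob P (fun ω => φ (B ω)) _) = _
  ring

lemma condEntropy_le_condEntropy_comp (φ : β → γ) :
    condEntropy P A B ≤ condEntropy P A (fun ω => φ (B ω)) := by
  rw [condEntropy_comp_eq_sum P A B φ]
  refine condEntropy_le_crossEntropy P A B
    (fun b a => prob P (pair A fun ω => φ (B ω)) (a, φ b) / prob P (fun ω => φ (B ω)) (φ b))
    (fun _ _ => div_nonneg (prob_nonneg _ _ _) (prob_nonneg _ _ _)) (fun b => ?_) fun a b h => ?_
  · rw [← Finset.sum_div, ← prob_snd_eq_sum]
    exact div_self_le_one _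
  · have hle : prob P (pair A B) (a, b) ≤ prob P (pair A fun ω => φ (B ω)) (a, φ b) :=
      prob_le_prob_comp P (pair A B) (fun x => (x.1, φ x.2)) (a, b)
    refine le_antisymm ?_ (prob_nonneg _ _ _)
    rcases div_eq_zero_iff.1 h with h | h
    · exact h ▸ hle
    · exact h ▸ hle.trans (prob_pair_le_snd P A (fun ω => φ (B ω)) a (φ b))

lemma condEntropy_nonneg : 0 ≤ condEntropy P A B :=
  Finset.sum_nonneg fun b _ => mul_nonneg (prob_nonneg _ _ _) <| Finset.sum_nonneg fun a _ =>
    negMulLog_nonneg (div_nonneg (prob_nonneg _ _ _) (prob_nonneg _ _ _))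
      (div_le_one_of_le₀ (prob_pair_le_snd P A B a b) (prob_nonneg _ _ _))

lemma entropy_map {Ω α β : Type*} [Fintype β] (P : PMF Ω) (F : Ω → α) (G : α → β) :
    entropy (P.map F) G = entropy P (fun ω => G (F ω)) := by
  simp [entropy, prob_map]

variable {A B C}

lemma exists_eq_comp_of_factorsThrough {Ω α β : Type*} (P : PMF Ω) {A : Ω → α} {B : Ω → β}
    (h : A.FactorsThrough B) : ∃ φ : β → α, A = fun ω => φ (B ω) :=
  have : Nonempty α := P.support_nonempty.to_type.map A
  (factorsThrough_iff A).1 h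

lemma entropy_le_of_factorsThrough (h : A.FactorsThrough B) : entropy P A ≤ entropy P B := by
  obtain ⟨φ, rfl⟩ := exists_eq_comp_of_factorsThrough P h
  rw [entropy_comp_eq_sum, entropy_eq_sum]
  refine Finset.sum_le_sum fun b _ => ?_
  rcases (prob_nonneg P B b).eq_or_lt with h0 | hpos
  · simp [← h0]
  · gcongr
    exact prob_le_prob_comp P B φ b

lemma entropy_congr (h : ∀ ω ω', A ω = A ω' ↔ B ω = B ω') : entropy P A = entropy P B :=
  le_antisymm (entropy_le_of_factorsThrough P fun ω ω' => (h ω ω').2)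
    (entropy_le_of_factorsThrough P fun ω ω' => (h ω ω').1)

lemma condEntropy_congr {A' : Ω → γ} {B' : Ω → δ} (hA : ∀ ω ω', A ω = A ω' ↔ A' ω = A' ω')
    (hB : ∀ ω ω', B ω = B ω' ↔ B' ω = B' ω') : condEntropy P A B = condEntropy P A' B' := by
  rw [condEntropy_eq, condEntropy_eq, entropy_congr P hB,
    entropy_congr P (A := pair A B) (B := pair A' B')]
  intro ω ω'
  simp [pair, hA ω ω', hB ω ω']

variable (A B C)

lemma entropy_pair_comm : entropy P (pair A B) = entropy P (pair B A) :=
  entropy_congr P fun ω ω' => by simp [pair, and_comm]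

lemma condEntropy_mono {B : Ω → β} {C : Ω → γ} (h : C.FactorsThrough B) :
    condEntropy P A B ≤ condEntropy P A C := by
  obtain ⟨φ, rfl⟩ := exists_eq_comp_of_factorsThrough P h
  exact condEntropy_le_condEntropy_comp P A B φ

lemma condEntropy_pair_le : condEntropy P A (pair B C) ≤ condEntropy P A C :=
  condEntropy_mono P A fun _ _ h => (Prod.mk.inj h).2

lemma entropy_of_subsingleton [Subsingleton α] : entropy P A = 0 := by
  simp [entropy, prob_eq_one]

lemma condEntropy_of_subsingleton [Subsingleton β] : condEntropy P A B = entropy P A := by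
  rw [condEntropy_eq, entropy_of_subsingleton P B, sub_zero]
  exact entropy_congr P fun ω ω' => by simp [pair, Subsingleton.elim (B ω) (B ω')]

lemma condEntropy_le_entropy : condEntropy P A B ≤ entropy P A := by
  rw [← condEntropy_of_subsingleton P A fun _ => ()]
  exact condEntropy_mono P A fun _ _ _ => rfl

lemma condEntropy_eq_zero [Subsingleton α] : condEntropy P A B = 0 :=
  le_antisymm ((condEntropy_le_entropy P A B).trans_eq (entropy_of_subsingleton P A))
    (condEntropy_nonneg P A B)

lemma mutualInfo_nonneg : 0 ≤ mutualInfo P A B := sub_nonneg.2 (condEntropy_le_entropy P A B)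

lemma condMutualInfo_nonneg : 0 ≤ condMutualInfo P A B C :=
  sub_nonneg.2 (condEntropy_pair_le P A B C)

lemma mutualInfo_eq : mutualInfo P A B = entropy P B - condEntropy P B A := by
  rw [mutualInfo, condEntropy_eq, condEntropy_eq, entropy_pair_comm P A B]
  ring

lemma condMutualInfo_eq :
    condMutualInfo P A B C = condEntropy P B C - condEntropy P B (pair C A) := by
  have hperm : entropy P (pair A (pair B C)) = entropy P (pair B (pair C A)) :=
    entropy_congr P fun ω ω' => by simp only [pair, Prod.mk.injEq]; tauto
  simp only [condMutualInfo, condEntropy_eq, hperm, entropy_pair_comm P A C]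
  ring

end Entropy

section SmallSupport

variable {K E : Type*} [Fintype K]

lemma exists_boundary_step {w g : K → ℝ} (hw : 0 ≤ w) (hg : support g ⊆ support w)
    (hneg : ∃ k, g k < 0) :
    ∃ t : ℝ, 0 < t ∧ 0 ≤ w + t • g ∧ support (w + t • g) ⊂ support w := by
  have hne : (Finset.univ.filter fun k => g k < 0).Nonempty := by
    simpa [Finset.filter_nonempty_iff] using hneg
  obtain ⟨k₀, hk₀, hmin⟩ := Finset.exists_min_image _ (fun k => w k / -g k) hne
  simp only [Finset.mem_filter, Finset.mem_univ, true_and] at hk₀ hmin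
  have hw₀ : 0 < w k₀ := (hw k₀).lt_of_ne' (hg hk₀.ne)
  have ht : 0 < w k₀ / -g k₀ := div_pos hw₀ (neg_pos.2 hk₀)
  refine ⟨w k₀ / -g k₀, ht, fun k => ?_, fun k hk hwk => hk ?_, fun hsub => hsub hw₀.ne' ?_⟩
  · rcases lt_or_ge (g k) 0 with h | h
    · have hle := (le_div_iff₀ (neg_pos.2 h)).1 (hmin k h)
      simp only [Pi.zero_apply, Pi.add_apply, Pi.smul_apply, smul_eq_mul]
      linarith
    · exact add_nonneg (hw k) (mul_nonneg ht.le h)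
  · simp [hwk, notMem_support.1 fun hgk => hg hgk hwk]
  · have := hk₀.ne
    simp only [Pi.add_apply, Pi.smul_apply, smul_eq_mul]
    field_simp
    ring

variable [AddCommGroup E] [Module ℝ E] (A : K → E)

lemma exists_relation_of_finrank_lt [FiniteDimensional ℝ E] {w : K → ℝ}
    (h : Module.finrank ℝ E < (support w).ncard) :
    ∃ g : K → ℝ, g ≠ 0 ∧ support g ⊆ support w ∧ ∑ k, g k • A k = 0 := by
  have hdep : ¬ LinearIndepOn ℝ A ((support w).toFinset : Set K) := fun hli => by
    have hcard := LinearIndependent.fintype_card_le_finrank hli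
    simp only [Finset.coe_sort_coe, Fintype.card_coe, ← Set.ncard_eq_toFinset_card'] at hcard
    exact h.not_ge hcard
  obtain ⟨f, hf, k, hk, hfk⟩ := not_linearIndepOn_finset_iff.1 hdep
  refine ⟨(support w).indicator f, fun h0 => hfk ?_, Set.support_indicator_subset, ?_⟩
  · rw [← Set.indicator_of_mem (Set.mem_toFinset.1 hk) f, h0, Pi.zero_apply]
  · rw [← hf]
    refine (Finset.sum_subset (Finset.subset_univ _) fun k _ hk => ?_).symm.trans
      (Finset.sum_congr rfl fun k hk => ?_)
    · rw [Set.indicator_of_notMem (by simpa using hk), zero_smul]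
    · rw [Set.indicator_of_mem (Set.mem_toFinset.1 hk)]

variable {A}

lemma exists_neg_of_relation {l : E →ₗ[ℝ] ℝ} {g : K → ℝ} (hl : ∀ k ∈ support g, 0 < l (A k))
    (hg : g ≠ 0) (hsum : ∑ k, g k • A k = 0) : ∃ k, g k < 0 := by
  by_contra! hnonneg
  have hterm : ∀ k ∈ Finset.univ, 0 ≤ g k * l (A k) := fun k _ => by
    rcases eq_or_ne (g k) 0 with h | h
    · simp [h]
    · exact mul_nonneg (hnonneg k) (hl k h).le
  have hzero : ∑ k, g k * l (A k) = 0 := by simpa using congrArg l hsum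
  refine hg (funext fun k => by_contra fun hk => ?_)
  exact mul_ne_zero hk (hl k hk).ne'
    ((Finset.sum_eq_zero_iff_of_nonneg hterm).1 hzero k (Finset.mem_univ k))

variable (A) in
/-- The nonnegative weights with the same weighted sum of the vectors `A k` as `w` that are
supported on at most `dim E` of the indices in the support of `w`. -/
def smallSupport (w : K → ℝ) : Set (K → ℝ) :=
  {v | 0 ≤ v ∧ support v ⊆ support w ∧ ∑ k, v k • A k = ∑ k, w k • A k ∧
    (support v).ncard ≤ Module.finrank ℝ E}

lemma smallSupport_mono {v w : K → ℝ} (hsupp : support v ⊆ support w)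
    (hsum : ∑ k, v k • A k = ∑ k, w k • A k) : smallSupport A v ⊆ smallSupport A w :=
  fun _ ⟨h0, hs, heq, hcard⟩ => ⟨h0, hs.trans hsupp, heq.trans hsum, hcard⟩

-- If the support is too large, `w` lies on a segment whose ends have smaller supports.
lemma mem_convexHull_smallSupport [FiniteDimensional ℝ E] {l : E →ₗ[ℝ] ℝ} {w : K → ℝ}
    (hw : 0 ≤ w) (hl : ∀ k ∈ support w, 0 < l (A k)) : w ∈ convexHull ℝ (smallSupport A w) := by
  induction hn : (support w).ncard using Nat.strong_induction_on generalizing w with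
  | _ n ih =>
  by_cases hdim : (support w).ncard ≤ Module.finrank ℝ E
  · exact subset_convexHull ℝ _ ⟨hw, subset_rfl, rfl, hdim⟩
  have hstep : ∀ g : K → ℝ, g ≠ 0 → support g ⊆ support w → ∑ k, g k • A k = 0 →
      ∃ t : ℝ, 0 < t ∧ w + t • g ∈ convexHull ℝ (smallSupport A w) := by
    intro g hg hsupp hsum
    obtain ⟨t, ht, hnonneg, hss⟩ := exists_boundary_step hw hsupp
      (exists_neg_of_relation (fun k hk => hl k (hsupp hk)) hg hsum)
    refine ⟨t, ht, convexHull_mono (smallSupport_mono hss.subset ?_)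
      (ih _ (hn ▸ Set.ncard_lt_ncard hss) hnonneg (fun k hk => hl k (hss.subset hk)) rfl)⟩
    simp [add_smul, Finset.sum_add_distrib, mul_smul, ← Finset.smul_sum, hsum]
  obtain ⟨g, hg, hsupp, hsum⟩ := exists_relation_of_finrank_lt A (not_le.1 hdim)
  obtain ⟨t, ht, hwt⟩ := hstep g hg hsupp hsum
  obtain ⟨s, hs, hws⟩ := hstep (-g) (neg_ne_zero.2 hg) (by rwa [support_neg])
    (by simpa using hsum)
  have hst : s + t ≠ 0 := (add_pos hs ht).ne'
  convert convex_convexHull ℝ _ hwt hws (div_pos hs (add_pos hs ht)).le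
    (div_pos ht (add_pos hs ht)).le (by rw [← add_div, div_self hst]) using 1
  ext k
  simp only [Pi.add_apply, Pi.smul_apply, Pi.neg_apply, smul_eq_mul]
  field_simp
  ring

lemma exists_le_of_mem_convexHull {F : Type*} [AddCommGroup F] [Module ℝ F] {s : Set F} {x : F}
    (hx : x ∈ convexHull ℝ s) (f : F →ₗ[ℝ] ℝ) : ∃ y ∈ s, f y ≤ f x := by
  by_contra! h
  exact lt_irrefl (f x)
    (convexHull_min (t := {y | f x < f y}) h (convex_halfSpace_gt f.isLinear _) hx)

lemma exists_embedding_fin {s : Set K} {N : ℕ} (hs : s.ncard ≤ N) : Nonempty (s ↪ Fin N) :=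
  Embedding.nonempty_of_card_le (by
    rwa [Fintype.card_fin, ← Nat.card_eq_fintype_card, Nat.card_coe_set_eq])

end SmallSupport

section Splittings

variable {M E F : Type*} [AddCommGroup M] [Module ℝ M] [AddCommGroup E] [Module ℝ E]
  [AddCommGroup F] [Module ℝ F]

/-- `h` is positively homogeneous of degree one. -/
def PosHomogeneous (h : M → F) : Prop := ∀ ⦃c : ℝ⦄, 0 ≤ c → ∀ x, h (c • x) = c • h x

lemma PosHomogeneous.map_zero {h : M → F} (hh : PosHomogeneous h) : h 0 = 0 := by
  simpa using hh le_rfl 0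

/-- `s` is closed under nonnegative scaling, and the linear map `T` sends its nonzero elements into
an open half-space: the setting for Carathéodory's theorem on conic combinations. -/
structure IsSalient (T : M →ₗ[ℝ] E) (s : Set M) : Prop where
  zero_mem : 0 ∈ s
  smul_mem : ∀ ⦃c : ℝ⦄, 0 ≤ c → ∀ x ∈ s, c • x ∈ s
  exists_pos : ∃ l : E →ₗ[ℝ] ℝ, ∀ x ∈ s, x ≠ 0 → 0 < l (T x)

/-- The values `∑ i, h (A i)` over the families of `N` elements of `s` with `∑ i, T (A i) = t`. -/
def splitValues (T : M →ₗ[ℝ] E) (h : M → F) (s : Set M) (N : ℕ) (t : E) : Set F :=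
  {b | ∃ A : Fin N → M, (∀ i, A i ∈ s) ∧ ∑ i, T (A i) = t ∧ ∑ i, h (A i) = b}

variable {T : M →ₗ[ℝ] E} {h : M → F} {s : Set M} {N : ℕ} {t : E} {b : F}

lemma IsSalient.smul_mem_splitValues (hs : IsSalient T s) (hh : PosHomogeneous h) {c : ℝ}
    (hc : 0 ≤ c) (hb : b ∈ splitValues T h s N t) : c • b ∈ splitValues T h s N (c • t) := by
  obtain ⟨A, hA, rfl, rfl⟩ := hb
  refine ⟨fun i => c • A i, fun i => hs.smul_mem hc _ (hA i), ?_, ?_⟩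
  · simp [Finset.smul_sum]
  · simp [hh hc, Finset.smul_sum]

lemma IsSalient.zero_mem_splitValues (hs : IsSalient T s) (hh : PosHomogeneous h) :
    (0 : F) ∈ splitValues T h s N 0 :=
  ⟨0, fun _ => hs.zero_mem, by simp, by simp [hh.map_zero]⟩

lemma IsSalient.eq_zero_of_mem_splitValues_zero (hs : IsSalient T s) (hh : PosHomogeneous h)
    (hb : b ∈ splitValues T h s N 0) : b = 0 := by
  obtain ⟨A, hA, hsum, rfl⟩ := hb
  obtain ⟨l, hl⟩ := hs.exists_pos
  have hnonneg : ∀ i ∈ Finset.univ, 0 ≤ l (T (A i)) := fun i _ => by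
    rcases eq_or_ne (A i) 0 with h0 | h0
    · simp [h0]
    · exact (hl _ (hA i) h0).le
  have hzero : ∑ i, l (T (A i)) = 0 := by rw [← map_sum, hsum, map_zero]
  refine Finset.sum_eq_zero fun i hi => ?_
  have hAi : A i = 0 := by_contra fun h0 => (hl _ (hA i) h0).ne'
    ((Finset.sum_eq_zero_iff_of_nonneg hnonneg).1 hzero i hi)
  rw [hAi, hh.map_zero]

lemma PosHomogeneous.sum_extend_support (hh : PosHomogeneous h) {K ι : Type*} [Fintype K]
    [Fintype ι] (A : K → M) {v : K → ℝ} (hv : 0 ≤ v) (e : support v ↪ ι) :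
    ∑ i, h (extend e (fun k => v k • A k) 0 i) = ∑ k, v k • h (A k) := by
  calc ∑ i, h (extend e (fun k => v k • A k) 0 i) = ∑ k : support v, v k • h (A k) := by
        refine (Fintype.sum_of_injective e e.injective _ _ (fun i hi => ?_) fun k => ?_).symm
        · rw [extend_apply' _ _ _ hi, Pi.zero_apply, hh.map_zero]
        · rw [e.injective.extend_apply, hh (hv k)]
    _ = ∑ k, v k • h (A k) :=
        Fintype.sum_of_injective _ Subtype.val_injective _ _ (fun k hk => by
          rw [notMem_support.1 fun h' => hk ⟨⟨k, h'⟩, rfl⟩, zero_smul]) fun _ => rfl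

lemma sum_indicator_support_smul {K M F : Type*} [Fintype K] [Zero M] [AddCommGroup F]
    [Module ℝ F] {h : M → F} (h0 : h 0 = 0) (A : K → M) :
    ∑ k, (support A).indicator (1 : K → ℝ) k • h (A k) = ∑ k, h (A k) :=
  Finset.sum_congr rfl fun k _ => by by_cases hk : A k = 0 <;> simp [hk, h0]

lemma IsSalient.linearCombination_mem_splitValues (hs : IsSalient T s) (hh : PosHomogeneous h)
    {K : Type*} [Fintype K] {A : K → M} (hA : ∀ k, A k ∈ s) {v : K → ℝ} (hv : 0 ≤ v)
    (hcard : (support v).ncard ≤ N) :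
    ∑ k, v k • h (A k) ∈ splitValues T h s N (∑ k, v k • T (A k)) := by
  obtain ⟨e⟩ := exists_embedding_fin hcard
  refine ⟨extend e (fun k => v k • A k) 0, fun i => ?_, ?_, ?_⟩
  · by_cases hi : ∃ k, e k = i
    · obtain ⟨k, rfl⟩ := hi
      rw [e.injective.extend_apply]
      exact hs.smul_mem (hv _) _ (hA _)
    · rw [extend_apply' _ _ _ hi]
      exact hs.zero_mem
  · exact PosHomogeneous.sum_extend_support (fun c _ x => map_smul T c x) A hv e
  · exact hh.sum_extend_support A hv e

lemma IsSalient.sum_mem_convexHull_splitValues [FiniteDimensional ℝ E] (hs : IsSalient T s)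
    (hh : PosHomogeneous h) (hN : Module.finrank ℝ E ≤ N) {K : Type*} [Fintype K] {A : K → M}
    (hA : ∀ k, A k ∈ s) :
    ∑ k, h (A k) ∈ convexHull ℝ (splitValues T h s N (∑ k, T (A k))) := by
  obtain ⟨l, hl⟩ := hs.exists_pos
  set u : K → ℝ := (support A).indicator 1 with hu
  have hmem : u ∈ convexHull ℝ (smallSupport (fun k => T (A k)) u) :=
    mem_convexHull_smallSupport (Set.indicator_nonneg fun _ _ => zero_le_one)
      fun k hk => hl _ (hA k) (Set.mem_of_indicator_ne_zero hk)
  have himage := Set.mem_image_of_mem (Fintype.linearCombination ℝ fun k => h (A k)) hmem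
  rw [LinearMap.image_convexHull, Fintype.linearCombination_apply,
    sum_indicator_support_smul hh.map_zero] at himage
  refine convexHull_mono ?_ himage
  rintro _ ⟨v, ⟨hv, -, hsum, hcard⟩, rfl⟩
  rw [Fintype.linearCombination_apply, ← sum_indicator_support_smul (map_zero T), ← hu, ← hsum]
  exact hs.linearCombination_mem_splitValues hh hA hv (hcard.trans hN)

end Splittings

section Arrays

variable {F V₀ V₁ V₂ X : Type*} [AddCommGroup F] [Fintype V₀] [Fintype V₁] [Fintype V₂]

/-- For an array `r` of joint weights of `(V₀, V₁, V₂)` and `X`: the weights of `X`, followed by the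
totals of `h` over the weights of `X` restricted to the values of `V₀`, of `(V₀, V₁)` and of
`(V₀, V₂)`. -/
def arrayPoint (h : (X → ℝ) → F) (r : V₀ × V₁ × V₂ → X → ℝ) : (X → ℝ) × F × F × F :=
  (∑ i, ∑ j, ∑ k, r (i, j, k), ∑ i, h (∑ j, ∑ k, r (i, j, k)), ∑ i, ∑ j, h (∑ k, r (i, j, k)),
    ∑ i, ∑ k, h (∑ j, r (i, j, k)))

lemma continuous_arrayPoint [TopologicalSpace F] [ContinuousAdd F] {h : (X → ℝ) → F}
    (hh : Continuous h) : Continuous (arrayPoint (V₀ := V₀) (V₁ := V₁) (V₂ := V₂) h) := by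
  unfold arrayPoint
  fun_prop

variable [Module ℝ F] [Fintype X]

/-- The points `arrayPoint h r` of the arrays `r` with constant `V₀` in which `V₁` and `V₂` have
`|X|` values. -/
def atoms (h : (X → ℝ) → F) : Set ((X → ℝ) × F × F × F) :=
  {p | 0 ≤ p.1 ∧ p.2.1 = h p.1 ∧
    p.2.2.1 ∈ splitValues LinearMap.id h (Set.Ici 0) (Fintype.card X) p.1 ∧
    p.2.2.2 ∈ splitValues LinearMap.id h (Set.Ici 0) (Fintype.card X) p.1}

lemma isSalient_nonneg : IsSalient (LinearMap.id (R := ℝ) (M := X → ℝ)) (Set.Ici 0) where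
  zero_mem := le_refl (0 : X → ℝ)
  smul_mem _ hc _ hq := Set.mem_Ici.2 (smul_nonneg hc (Set.mem_Ici.1 hq))
  exists_pos := ⟨Fintype.linearCombination ℝ 1, fun q hq h0 => by
    simpa [Fintype.linearCombination_apply] using Fintype.sum_pos (lt_of_le_of_ne hq h0.symm)⟩

variable {h : (X → ℝ) → F}

lemma smul_mem_atoms (hh : PosHomogeneous h) {c : ℝ} (hc : 0 ≤ c) {p : (X → ℝ) × F × F × F}
    (hp : p ∈ atoms h) : c • p ∈ atoms h :=
  ⟨smul_nonneg hc hp.1, by simp [hp.2.1, hh hc],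
    isSalient_nonneg.smul_mem_splitValues hh hc hp.2.2.1,
    isSalient_nonneg.smul_mem_splitValues hh hc hp.2.2.2⟩

lemma zero_mem_atoms (hh : PosHomogeneous h) : 0 ∈ atoms h :=
  ⟨le_rfl, hh.map_zero.symm, isSalient_nonneg.zero_mem_splitValues hh,
    isSalient_nonneg.zero_mem_splitValues hh⟩

lemma eq_zero_of_mem_atoms (hh : PosHomogeneous h) {p : (X → ℝ) × F × F × F} (hp : p ∈ atoms h)
    (h0 : p.1 = 0) : p = 0 := by
  obtain ⟨q, a, b, c⟩ := p
  obtain rfl : q = 0 := h0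
  obtain ⟨-, ha, hb, hc⟩ := hp
  obtain rfl : a = h 0 := ha
  obtain rfl : b = 0 := isSalient_nonneg.eq_zero_of_mem_splitValues_zero hh hb
  obtain rfl : c = 0 := isSalient_nonneg.eq_zero_of_mem_splitValues_zero hh hc
  rw [hh.map_zero]
  rfl

lemma splittings_mem_hull_atoms (hh : PosHomogeneous h) {A : V₁ → X → ℝ} {B : V₂ → X → ℝ}
    (hA : ∀ j, 0 ≤ A j) (hB : ∀ k, 0 ≤ B k) (hAB : ∑ j, A j = ∑ k, B k) :
    (∑ j, A j, h (∑ j, A j), ∑ j, h (A j), ∑ k, h (B k)) ∈ PointedCone.hull ℝ (atoms h) := by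
  set q := ∑ j, A j
  have hdim : Module.finrank ℝ (X → ℝ) ≤ Fintype.card X := (Module.finrank_pi ℝ).le
  have hmem : (q, h q, ∑ j, h (A j), ∑ k, h (B k)) ∈ convexHull ℝ (({q} : Set (X → ℝ)) ×ˢ
      ({h q} : Set F) ×ˢ splitValues LinearMap.id h (Set.Ici 0) (Fintype.card X) q ×ˢ
      splitValues LinearMap.id h (Set.Ici 0) (Fintype.card X) q) := by
    simp only [convexHull_prod, convexHull_singleton]
    exact ⟨rfl, rfl, isSalient_nonneg.sum_mem_convexHull_splitValues hh hdim hA,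
      by rw [hAB]; exact isSalient_nonneg.sum_mem_convexHull_splitValues hh hdim hB⟩
  refine convexHull_min ?_ (PointedCone.convex _) hmem
  rintro ⟨_, _, b, c⟩ ⟨rfl, rfl, hb, hc⟩
  exact Submodule.subset_span ⟨Finset.sum_nonneg fun j _ => hA j, rfl, hb, hc⟩

lemma arrayPoint_mem_hull_atoms (hh : PosHomogeneous h) {r : V₀ × V₁ × V₂ → X → ℝ} (hr : 0 ≤ r) :
    arrayPoint h r ∈ PointedCone.hull ℝ (atoms h) := by
  have hsum := Submodule.sum_mem (PointedCone.hull ℝ (atoms h)) (t := Finset.univ) fun i _ =>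
    splittings_mem_hull_atoms hh (A := fun j => ∑ k, r (i, j, k)) (B := fun k => ∑ j, r (i, j, k))
      (fun j => Finset.sum_nonneg fun k _ => hr (i, j, k))
      (fun k => Finset.sum_nonneg fun j _ => hr (i, j, k)) Finset.sum_comm
  convert hsum using 1
  simp [arrayPoint, Prod.ext_iff, Prod.fst_sum, Prod.snd_sum]

lemma exists_sum_eq_of_mem_hull_atoms (hh : PosHomogeneous h) {p : (X → ℝ) × F × F × F}
    (hp : p ∈ PointedCone.hull ℝ (atoms h)) :
    ∃ (n : ℕ) (z : Fin n → (X → ℝ) × F × F × F), (∀ k, z k ∈ atoms h) ∧ ∑ k, z k = p := by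
  obtain ⟨n, c, z, rfl⟩ := Submodule.mem_span_set'.1 hp
  exact ⟨n, fun k => c k • (z k : (X → ℝ) × F × F × F),
    fun k => smul_mem_atoms hh (c k).2 (z k).2, rfl⟩

end Arrays

section CondProduct

variable {V₁ V₂ X : Type*} [Fintype V₁]

/-- The weights of conditionally independent `V₁` and `V₂` given `X`, from the weights `A` and `B`
of `(V₁, X)` and `(V₂, X)`. Where `X` has no weight, all four arrays vanish since `0 / 0 = 0`. -/
def condProduct (A : V₁ → X → ℝ) (B : V₂ → X → ℝ) :
    V₁ × V₂ → X → ℝ :=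
  fun v => A v.1 * B v.2 / ∑ j, A j

variable {A : V₁ → X → ℝ} {B : V₂ → X → ℝ}

lemma condProduct_nonneg (hA : ∀ j, 0 ≤ A j) (hB : ∀ k, 0 ≤ B k) : 0 ≤ condProduct A B :=
  fun v x => div_nonneg (mul_nonneg (hA v.1 x) (hB v.2 x))
    (Finset.sum_nonneg (fun j _ => hA j) x)

variable [Fintype V₂]

lemma sum_condProduct_snd (hA : ∀ j, 0 ≤ A j) (hAB : ∑ j, A j = ∑ k, B k) (j : V₁) :
    ∑ k, condProduct A B (j, k) = A j := by
  have hzero : ∀ x, (∑ j, A j) x = 0 → A j x = 0 := fun x hx =>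
    le_antisymm (hx ▸ Finset.single_le_sum (fun j _ => hA j) (Finset.mem_univ j) x) (hA j x)
  ext x
  simp only [condProduct, Finset.sum_apply, Pi.div_apply, Pi.mul_apply, ← Finset.sum_div,
    ← Finset.mul_sum] at hzero ⊢
  rw [← Finset.sum_apply x Finset.univ B, ← hAB, Finset.sum_apply]
  exact mul_div_cancel_of_imp (hzero x)

lemma condProduct_swap (hAB : ∑ j, A j = ∑ k, B k) (j : V₁) (k : V₂) :
    condProduct A B (j, k) = condProduct B A (k, j) := by
  simp only [condProduct, hAB, mul_comm]

end CondProduct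

section BoundedArrays

variable {X : Type*} {h : (X → ℝ) → ℝ × ℝ}

variable (X) in
/-- Drops the first component of the third entry, that is, `H(Y₁ | V₀, V₁)`. -/
def dropThirdFst :
    (X → ℝ) × (ℝ × ℝ) × (ℝ × ℝ) × (ℝ × ℝ) →ₗ[ℝ] (X → ℝ) × (ℝ × ℝ) × ℝ × (ℝ × ℝ) where
  toFun p := (p.1, p.2.1, p.2.2.1.2, p.2.2.2)
  map_add' _ _ := rfl
  map_smul' _ _ := rfl

variable (X) in
/-- The first component of the third entry, that is, `H(Y₁ | V₀, V₁)`. -/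
def thirdFst : (X → ℝ) × (ℝ × ℝ) × (ℝ × ℝ) × (ℝ × ℝ) →ₗ[ℝ] ℝ where
  toFun p := p.2.2.1.1
  map_add' _ _ := rfl
  map_smul' _ _ := rfl

variable [Fintype X]

lemma isSalient_atoms (hh : PosHomogeneous h) : IsSalient (dropThirdFst X) (atoms h) where
  zero_mem := zero_mem_atoms hh
  smul_mem _ hc _ hp := smul_mem_atoms hh hc hp
  exists_pos := by
    obtain ⟨l, hl⟩ := (isSalient_nonneg (X := X)).exists_pos
    exact ⟨l.comp (LinearMap.fst ℝ _ _), fun p hp h0 =>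
      hl p.1 hp.1 fun hp0 => h0 (eq_zero_of_mem_atoms hh hp hp0)⟩

-- Only `|X| + 5` coordinates are preserved: minimising the remaining one over the representations
-- by atoms is a linear program, and an extreme point has at most `|X| + 5` nonzero weights.
lemma exists_atoms_of_mem_hull (hh : PosHomogeneous h) {q : X → ℝ} {a b c : ℝ × ℝ}
    (hp : (q, a, b, c) ∈ PointedCone.hull ℝ (atoms h)) :
    ∃ (z : Fin (Fintype.card X + 5) → (X → ℝ) × (ℝ × ℝ) × (ℝ × ℝ) × (ℝ × ℝ)),
      ∃ b₁ ≤ b.1, (∀ i, z i ∈ atoms h) ∧ ∑ i, z i = (q, a, (b₁, b.2), c) := by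
  obtain ⟨n, z, hz, hsum⟩ := exists_sum_eq_of_mem_hull_atoms hh hp
  have hdim : Module.finrank ℝ ((X → ℝ) × (ℝ × ℝ) × ℝ × (ℝ × ℝ)) ≤ Fintype.card X + 5 := by
    simp [Module.finrank_prod]
  obtain ⟨b₁, ⟨z', hz', hT, rfl⟩, hle⟩ := exists_le_of_mem_convexHull
    ((isSalient_atoms hh).sum_mem_convexHull_splitValues (h := thirdFst X)
      (fun c _ x => map_smul _ c x) hdim hz) LinearMap.id
  rw [← map_sum, ← map_sum, hsum] at hT
  rw [LinearMap.id_apply, LinearMap.id_apply, ← map_sum, ← map_sum, hsum] at hle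
  refine ⟨z', thirdFst X (∑ i, z' i), hle, hz', ?_⟩
  simp only [dropThirdFst, LinearMap.coe_mk, AddHom.coe_mk, Prod.mk.injEq] at hT
  obtain ⟨hq, ha, hb, hc⟩ := hT
  exact Prod.ext hq (Prod.ext ha (Prod.ext (Prod.ext rfl hb) hc))

lemma exists_array_of_mem_hull_atoms (hh : PosHomogeneous h) {q : X → ℝ} {a b c : ℝ × ℝ}
    (hp : (q, a, b, c) ∈ PointedCone.hull ℝ (atoms h)) :
    ∃ r : Fin (Fintype.card X + 5) × Fin (Fintype.card X) × Fin (Fintype.card X) → X → ℝ,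
      ∃ b₁ ≤ b.1, 0 ≤ r ∧ arrayPoint h r = (q, a, (b₁, b.2), c) := by
  obtain ⟨z, b₁, hb₁, hz, hsum⟩ := exists_atoms_of_mem_hull hh hp
  choose A hA hAz hAb using fun i => (hz i).2.2.1
  choose B hB hBz hBc using fun i => (hz i).2.2.2
  simp only [LinearMap.id_apply] at hAz hBz
  have hAB : ∀ i, ∑ j, A i j = ∑ k, B i k := fun i => (hAz i).trans (hBz i).symm
  have hV₁ : ∀ i j, ∑ k, condProduct (A i) (B i) (j, k) = A i j := fun i =>
    sum_condProduct_snd (hA i) (hAB i)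
  have hV₂ : ∀ i k, ∑ j, condProduct (A i) (B i) (j, k) = B i k := fun i k => by
    simp only [condProduct_swap (hAB i)]
    exact sum_condProduct_snd (hB i) (hAB i).symm k
  refine ⟨fun v => condProduct (A v.1) (B v.1) v.2, b₁, hb₁,
    fun v => condProduct_nonneg (hA v.1) (hB v.1) v.2, ?_⟩
  rw [← hsum]
  simp only [arrayPoint, hV₁, hV₂, hAz, hAb, hBc, ← fun i => (hz i).2.1]
  simp only [Prod.ext_iff, Prod.fst_sum, Prod.snd_sum, and_self]

end BoundedArrays

section OutEntropy

variable {X Y Y₁ Y₂ : Type*} [Fintype X] [Fintype Y] [Fintype Y₁] [Fintype Y₂] (W : X → PMF Y)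

/-- For an input measure `q` of mass `c`, this is `c` times the entropy of the output of the channel
`W` under the input law `q / c`. The scaling makes it positively homogeneous, so that conditional
output entropies are sums of its values. -/
def outEntropy (q : X → ℝ) : ℝ :=
  ∑ y, negMulLog (∑ x, q x * (W x y).toReal) - negMulLog (∑ x, q x)

lemma sum_output (q : X → ℝ) : ∑ y, ∑ x, q x * (W x y).toReal = ∑ x, q x := by
  rw [Finset.sum_comm]
  simp [← Finset.mul_sum, sum_toReal_pmf]

lemma outEntropy_smul (c : ℝ) (q : X → ℝ) : outEntropy W (c • q) = c * outEntropy W q := by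
  simp only [outEntropy, Pi.smul_apply, smul_eq_mul, mul_assoc, ← Finset.mul_sum, negMulLog_mul,
    Finset.sum_add_distrib, ← Finset.sum_mul, sum_output]
  ring

lemma outEntropy_single (c : ℝ) (x : X) :
    outEntropy W (Pi.single x c) = c * outEntropy W (Pi.single x 1) := by
  rw [← outEntropy_smul, ← Pi.single_smul, smul_eq_mul, mul_one]

lemma concaveOn_outEntropy : ConcaveOn ℝ (stdSimplex ℝ X) (outEntropy W) := by
  have hlin (y : Y) (q : X → ℝ) : ∑ x, q x * (W x y).toReal =
      Fintype.linearCombination ℝ (fun x => (W x y).toReal) q := rfl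
  refine ⟨convex_stdSimplex ℝ X, fun q hq q' hq' s t hs ht hst => ?_⟩
  have hmem := convex_stdSimplex ℝ X hq hq' hs ht hst
  simp only [outEntropy, hq.2, hq'.2, hmem.2, negMulLog_one, sub_zero, smul_eq_mul, Finset.mul_sum,
    ← Finset.sum_add_distrib, hlin, map_add, map_smul]
  have hnonneg (y : Y) (q : X → ℝ) (hq : q ∈ stdSimplex ℝ X) :
      0 ≤ Fintype.linearCombination ℝ (fun x => (W x y).toReal) q :=
    Finset.sum_nonneg fun x _ => mul_nonneg (hq.1 x) ENNReal.toReal_nonneg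
  exact Finset.sum_le_sum fun y _ =>
    concaveOn_negMulLog.2 (hnonneg y q hq) (hnonneg y q' hq') hs ht hst

lemma continuous_outEntropy : Continuous (outEntropy W) := by
  unfold outEntropy
  fun_prop

/-- The channel to a function `ψ` of the output. -/
def outputMap {Z : Type*} (W : X → PMF Y) (ψ : Y → Z) (x : X) : PMF Z := (W x).map ψ

/-- The output entropies `outEntropy` of the two receivers of a broadcast channel. -/
def outEntropies (W : X → PMF (Y₁ × Y₂)) (q : X → ℝ) : ℝ × ℝ :=
  (outEntropy (outputMap W Prod.fst) q, outEntropy (outputMap W Prod.snd) q)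

lemma posHomogeneous_outEntropies (W : X → PMF (Y₁ × Y₂)) : PosHomogeneous (outEntropies W) :=
  fun c _ q => by simp only [outEntropies, outEntropy_smul, Prod.smul_mk, smul_eq_mul]

lemma continuous_outEntropies (W : X → PMF (Y₁ × Y₂)) : Continuous (outEntropies W) :=
  (continuous_outEntropy _).prodMk (continuous_outEntropy _)

end OutEntropy

section Markov

variable {Ω Ω' V V' X Y Z : Type*} {P : PMF Ω} {v : Ω → V} {x : Ω → X} {y : Ω → Y} {W : X → PMF Y}

/-- `V → X → Y` is a Markov chain in which `Y` is the output of the channel `W` with input `X`. -/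
def IsMarkov (P : PMF Ω) (v : Ω → V) (x : Ω → X) (y : Ω → Y) (W : X → PMF Y) : Prop :=
  P.map (pair (pair v x) y) = (P.map (pair v x)).bind fun z => (W z.2).map (Prod.mk z)

lemma isMarkov_pure (P : PMF Ω) (v : Ω → V) (x : Ω → X) : IsMarkov P v x x PMF.pure := by
  have hmap : P.map (pair (pair v x) x) = (P.map (pair v x)).map fun z => (z, z.2) :=
    (PMF.map_comp (pair v x) P fun z => (z, z.2)).symm
  rw [IsMarkov, hmap, ← PMF.bind_pure_comp]
  simp only [PMF.pure_map]
  rfl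

lemma isMarkov_bind_map (R : PMF V) (φ : V → X) (W : X → PMF Y) :
    IsMarkov (R.bind fun a => (W (φ a)).map (Prod.mk a)) Prod.fst (fun ω => φ ω.1) Prod.snd W := by
  have hconst (a : V) : (W (φ a)).map (pair Prod.fst (fun ω : V × Y => φ ω.1) ∘ Prod.mk a) =
      PMF.pure (a, φ a) := PMF.map_const _ (a, φ a)
  simp only [IsMarkov, PMF.map_bind, PMF.map_comp, PMF.bind_bind, hconst, PMF.pure_bind]
  rfl

lemma isMarkov_map_iff {F : Ω' → Ω} {P : PMF Ω'} :
    IsMarkov (P.map F) v x y W ↔ IsMarkov P (v ∘ F) (x ∘ F) (y ∘ F) W := by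
  simp only [IsMarkov, PMF.map_comp]
  rfl

lemma IsMarkov.comp (h : IsMarkov P v x y W) (φ : V → X → V') :
    IsMarkov P (fun ω => φ (v ω) (x ω)) x y W := by
  have hmap := congrArg (PMF.map fun z : (V × X) × Y => ((φ z.1.1 z.1.2, z.1.2), z.2)) h
  rw [PMF.map_comp, PMF.map_bind] at hmap
  refine hmap.trans ?_
  rw [show pair (fun ω => φ (v ω) (x ω)) x = (fun z : V × X => (φ z.1 z.2, z.2)) ∘ pair v x
    from rfl, ← PMF.map_comp, PMF.bind_map (P.map (pair v x))]
  simp only [PMF.map_comp]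
  rfl

lemma IsMarkov.of_factorsThrough {v' : Ω → V'} (h : IsMarkov P v x y W)
    (hv : v'.FactorsThrough v) : IsMarkov P v' x y W := by
  obtain ⟨φ, rfl⟩ := exists_eq_comp_of_factorsThrough P hv
  exact h.comp fun a _ => φ a

lemma IsMarkov.comp_output (h : IsMarkov P v x y W) (ψ : Y → Z) :
    IsMarkov P v x (fun ω => ψ (y ω)) (outputMap W ψ) := by
  have hmap := congrArg (PMF.map (Prod.map id ψ)) h
  rw [PMF.map_comp, PMF.map_bind] at hmap
  refine hmap.trans ?_
  simp only [outputMap, PMF.map_comp]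
  rfl

lemma IsMarkov.prob_eq (h : IsMarkov P v x y W) (a : V) (b : X) (c : Y) :
    prob P (pair (pair v x) y) ((a, b), c) = prob P (pair v x) (a, b) * (W b c).toReal := by
  have hterm (z : V × X) (hz : z ≠ (a, b)) : (W z.2).map (Prod.mk z) ((a, b), c) = 0 := by
    rw [PMF.apply_eq_zero_iff, PMF.support_map]
    rintro ⟨c', -, hc'⟩
    exact hz (congrArg Prod.fst hc')
  have hpoint : (W b).map (Prod.mk (a, b)) ((a, b), c) = W b c := by
    rw [PMF.map_apply, tsum_eq_single c fun c' hc' => by simp [hc'.symm], if_pos rfl]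
  rw [prob, h, PMF.bind_apply, tsum_eq_single (a, b) fun z hz => by rw [hterm z hz, mul_zero],
    hpoint, ENNReal.toReal_mul]
  rfl

/-- The joint weights of `V` and `X`, as an array of measures on the values of `X`. -/
def jointArray (P : PMF Ω) (v : Ω → V) (x : Ω → X) (a : V) (b : X) : ℝ := prob P (pair v x) (a, b)

lemma jointArray_nonneg (P : PMF Ω) (v : Ω → V) (x : Ω → X) : 0 ≤ jointArray P v x :=
  fun _ _ => prob_nonneg _ _ _

variable [Fintype V] [Fintype X]

lemma jointArray_comp (P : PMF Ω) (v : Ω → V) (x : Ω → X) (φ : V → V') (a : V') :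
    jointArray P (fun ω => φ (v ω)) x a = ∑ a', if φ a' = a then jointArray P v x a' else 0 := by
  ext b
  have hcomp := prob_comp P (pair v x) (Prod.map φ id) (a, b)
  simp only [Fintype.sum_prod_type, Prod.map, id, Prod.mk.injEq, ite_and] at hcomp
  rw [Finset.sum_apply]
  refine hcomp.trans (Finset.sum_congr rfl fun a' _ => ?_)
  split_ifs <;> simp [jointArray]

lemma sum_jointArray (P : PMF Ω) (v : Ω → V) (x : Ω → X) : ∑ a, jointArray P v x a = prob P x := by
  ext b
  rw [Finset.sum_apply, prob_snd_eq_sum P v x]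
  rfl

variable [Fintype Y]

lemma IsMarkov.condEntropy_eq (h : IsMarkov P v x y W) :
    condEntropy P y v = ∑ a, outEntropy W (jointArray P v x a) := by
  have hjoint (c : Y) (a : V) :
      prob P (pair y v) (c, a) = ∑ b, jointArray P v x a b * (W b c).toReal := by
    have hswap := prob_comp P (pair (pair v x) y) (fun z => (z.2, z.1.1)) (c, a)
    simp only [Fintype.sum_prod_type, Prod.mk.injEq, ite_and, Finset.sum_ite_eq', Finset.mem_univ,
      if_true, h.prob_eq] at hswap
    rw [Finset.sum_comm] at hswap
    simp only [Finset.sum_ite_eq', Finset.mem_univ, if_true] at hswap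
    exact hswap
  simp only [BroadcastSource.condEntropy_eq, entropy, Fintype.sum_prod_type_right,
    ← Finset.sum_sub_distrib, outEntropy, hjoint, prob_fst_eq_sum P v x]
  rfl

omit [Fintype V] in
lemma IsMarkov.entropy_eq (h : IsMarkov P v x y W) : entropy P y = outEntropy W (prob P x) := by
  rw [← condEntropy_of_subsingleton P y fun _ => (), (h.comp fun _ _ => ()).condEntropy_eq,
    ← sum_jointArray P (fun _ => ()) x, Fintype.sum_unique, Fintype.sum_unique]

lemma IsMarkov.condEntropy_pair_input (h : IsMarkov P v x y W) :
    condEntropy P y (pair v x) = ∑ b, prob P x b * outEntropy W (Pi.single b 1) := by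
  have hsingle (z : V × X) :
      jointArray P (pair v x) x z = Pi.single z.2 (prob P (pair v x) z) := by
    ext b
    have hcomp := prob_comp P (pair v x) (fun z => (z, z.2)) (z, b)
    simp only [Prod.mk.injEq, ite_and, Finset.sum_ite_eq', Finset.mem_univ, if_true] at hcomp
    rw [Pi.single_apply]
    simp only [eq_comm (a := b)]
    exact hcomp
  have hpair : IsMarkov P (pair v x) x y W := h.comp Prod.mk
  rw [hpair.condEntropy_eq]
  simp only [hsingle, outEntropy_single W (prob P _ _)]
  exact (sum_prob_comp P (pair v x) Prod.snd fun b => outEntropy W (Pi.single b 1)).symm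

end Markov

section Laws

variable {V X : Type*}

lemma exists_pmf_of_mem_stdSimplex [Fintype X] {q : X → ℝ} (hq : q ∈ stdSimplex ℝ X) :
    ∃ P : PMF X, ∀ x, (P x).toReal = q x := by
  refine ⟨PMF.ofFintype (fun x => ENNReal.ofReal (q x)) ?_, fun x => ?_⟩
  · rw [← ENNReal.ofReal_sum_of_nonneg fun x _ => hq.1 x, hq.2, ENNReal.ofReal_one]
  · simp [hq.1 x]

lemma toReal_mem_stdSimplex [Fintype X] (P : PMF X) : (fun x => (P x).toReal) ∈ stdSimplex ℝ X :=
  ⟨fun _ => ENNReal.toReal_nonneg, sum_toReal_pmf P⟩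

/-- The weights of the joint law `p_{V|X} p_X`. -/
def inputArray (pX : PMF X) (pV : X → PMF V) (v : V) (x : X) : ℝ :=
  (pX x).toReal * (pV x v).toReal

variable (pX : PMF X) (pV : X → PMF V)

lemma inputArray_nonneg : 0 ≤ inputArray pX pV :=
  fun _ _ => mul_nonneg ENNReal.toReal_nonneg ENNReal.toReal_nonneg

lemma sum_inputArray [Fintype V] : ∑ v, inputArray pX pV v = fun x => (pX x).toReal := by
  ext x
  simp [inputArray, ← Finset.mul_sum, sum_toReal_pmf]

variable {pX} in
lemma exists_inputArray_eq [Fintype V] {r : V → X → ℝ} (hr : 0 ≤ r)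
    (hsum : ∑ v, r v = fun x => (pX x).toReal) : ∃ pV : X → PMF V, inputArray pX pV = r := by
  replace hsum (x : X) : ∑ v, r v x = (pX x).toReal := by rw [← congrFun hsum x, Finset.sum_apply]
  have hkernel (x : X) (hx : (pX x).toReal ≠ 0) :
      ∃ k : PMF V, ∀ v, (k v).toReal = r v x / (pX x).toReal :=
    exists_pmf_of_mem_stdSimplex ⟨fun v => div_nonneg (hr v x) ENNReal.toReal_nonneg,
      by rw [← Finset.sum_div, hsum, div_self hx]⟩
  obtain ⟨x₀, hx₀⟩ := pX.support_nonempty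
  obtain ⟨k₀, -⟩ := hkernel x₀ (ENNReal.toReal_ne_zero.2 ⟨hx₀, pX.apply_ne_top x₀⟩)
  have hex (x : X) : ∃ k : PMF V, ∀ v, (pX x).toReal * (k v).toReal = r v x := by
    by_cases hx : (pX x).toReal = 0
    · have hzero := (Finset.sum_eq_zero_iff_of_nonneg fun v _ => hr v x).1 ((hsum x).trans hx)
      exact ⟨k₀, fun v => by rw [hx, zero_mul, hzero v (Finset.mem_univ v)]⟩
    · obtain ⟨k, hk⟩ := hkernel x hx
      exact ⟨k, fun v => by rw [hk, mul_div_cancel₀ _ hx]⟩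
  choose k hk using hex
  exact ⟨k, funext₂ fun v x => hk x v⟩

end Laws

section JointLaws

variable {U V V₀ V₁ V₂ X Y Y₁ Y₂ S₁ S₂ T : Type*}

/-- The joint law `p_{V|X} p_X` of `(V, X)`. -/
def inputLaw (pX : PMF X) (pV : X → PMF V) : PMF (V × X) :=
  pX.bind fun x => (pV x).map fun v => (v, x)

lemma inputLaw_map_snd (pX : PMF X) (pV : X → PMF V) : (inputLaw pX pV).map Prod.snd = pX := by
  have hconst (x : X) : (pV x).map (Prod.snd ∘ fun v => (v, x)) = PMF.pure x := PMF.map_const _ x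
  simp only [inputLaw, PMF.map_bind, PMF.map_comp, hconst, PMF.bind_pure]

lemma toReal_inputLaw (pX : PMF X) (pV : X → PMF V) (v : V) (x : X) :
    (inputLaw pX pV (v, x)).toReal = inputArray pX pV v x := by
  have hne (x' : X) (hx : x' ≠ x) : (pV x').map (fun v => (v, x')) (v, x) = 0 := by
    rw [PMF.apply_eq_zero_iff, PMF.support_map]
    rintro ⟨v', -, hv⟩
    exact hx (congrArg Prod.snd hv)
  have heq : (pV x).map (fun v => (v, x)) (v, x) = pV x v := by
    rw [PMF.map_apply, tsum_eq_single v fun v' hv => by simp [hv.symm], if_pos rfl]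
  rw [inputLaw, PMF.bind_apply, tsum_eq_single x fun x' hx => by rw [hne x' hx, mul_zero], heq,
    ENNReal.toReal_mul]
  rfl

lemma entropy_sourceJoint [Fintype T] (p : PMF (S₁ × S₂)) (pU : S₁ × S₂ → PMF U)
    (A : S₁ × S₂ → T) : entropy (sourceJoint p pU) (fun ω => A ω.2) = entropy p A := by
  rw [← entropy_map (sourceJoint p pU) Prod.snd A]
  exact congrArg (entropy · A) (inputLaw_map_snd p pU)

lemma jointArray_sourceJoint (p : PMF (S₁ × S₂)) (pU : S₁ × S₂ → PMF U) :
    jointArray (sourceJoint p pU) (fun ω => ω.1) (fun ω => ω.2) = inputArray p pU := by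
  ext u s
  rw [← toReal_inputLaw]
  exact prob_id (inputLaw p pU) (u, s)

lemma channelJoint_eq_map (pX : PMF X) (pV : X → PMF (V₀ × V₁ × V₂)) (W : X → PMF (Y₁ × Y₂)) :
    channelJoint pX pV W = ((inputLaw pX pV).bind fun a => (W a.2).map (Prod.mk a)).map
      fun ω => (ω.1.1, ω.1.2, ω.2) := by
  simp only [channelJoint, inputLaw, PMF.map_bind, PMF.bind_bind, PMF.bind_map, PMF.map_comp,
    Function.comp_apply]
  rfl

lemma isMarkov_channelJoint (pX : PMF X) (pV : X → PMF (V₀ × V₁ × V₂)) (W : X → PMF (Y₁ × Y₂)) :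
    IsMarkov (channelJoint pX pV W) (fun ω => ω.1) (fun ω => ω.2.1) (fun ω => ω.2.2) W := by
  rw [channelJoint_eq_map, isMarkov_map_iff]
  exact (isMarkov_bind_map (inputLaw pX pV) Prod.snd W).comp fun a _ => a.1

lemma jointArray_channelJoint (pX : PMF X) (pV : X → PMF (V₀ × V₁ × V₂))
    (W : X → PMF (Y₁ × Y₂)) :
    jointArray (channelJoint pX pV W) (fun ω => ω.1) (fun ω => ω.2.1) = inputArray pX pV := by
  have hconst (a : (V₀ × V₁ × V₂) × X) :
      (W a.2).map (fun _ : Y₁ × Y₂ => a) = PMF.pure a := PMF.map_const _ a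
  have hmap : (channelJoint pX pV W).map (pair (fun ω => ω.1) fun ω => ω.2.1) = inputLaw pX pV := by
    rw [channelJoint_eq_map, PMF.map_comp, PMF.map_bind]
    simp only [PMF.map_comp]
    exact (congrArg _ (funext hconst)).trans (PMF.bind_pure _)
  ext v x
  rw [← toReal_inputLaw, ← hmap]
  rfl

end JointLaws

section TenInequalities

variable {Ω Ω' U S₁ S₂ V₀ V₁ V₂ X Y₁ Y₂ : Type*}

/-- The left-hand sides of the inequalities of `Dominated`, in terms of `(H(S₁), H(S₂))` and
`(H(S₁|U), H(S₂|U), H(S₁,S₂|U))`. -/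
def sourceSide : (ℝ × ℝ) × (ℝ × ℝ × ℝ) →ₗ[ℝ] (Fin 10 → ℝ) where
  toFun := fun (k, a) =>
    ![k.1 - a.1, k.2 - a.2.1, k.1, k.2, k.1 - a.1 + a.2.1, k.2 - a.2.1 + a.1,
      k.1 - a.1 + a.2.2, k.2 - a.2.1 + a.2.2, k.1 - a.1 + a.2.2, k.2 - a.2.1 + a.2.2]
  map_add' _ _ := by ext i; fin_cases i <;> simp <;> ring
  map_smul' _ _ := by ext i; fin_cases i <;> simp <;> ring

/-- The right-hand sides of the inequalities of `Dominated`, without the factor `κ`, in terms of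
`(H(Y₁), H(Y₂))`, of `(H(Y₁|X), H(Y₂|X))` and of the conditional entropies of `(Y₁, Y₂)` given
`V₀`, given `(V₀, V₁)` and given `(V₀, V₂)`. -/
def channelSide : (ℝ × ℝ) × (ℝ × ℝ) × ((ℝ × ℝ) × (ℝ × ℝ) × (ℝ × ℝ)) →ₗ[ℝ] (Fin 10 → ℝ) where
  toFun := fun (h, e, a, b, c) =>
    ![h.1 - a.1, h.2 - a.2, h.1 - b.1, h.2 - c.2, h.1 - a.1 + a.2 - c.2, h.2 - a.2 + a.1 - b.1,
      h.1 - b.1 + b.2 - e.2, h.2 - c.2 + c.1 - e.1, h.1 - a.1 + a.2 - c.2 + c.1 - e.1,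
      h.2 - a.2 + a.1 - b.1 + b.2 - e.2]
  map_add' _ _ := by ext i; fin_cases i <;> simp <;> ring
  map_smul' _ _ := by ext i; fin_cases i <;> simp <;> ring

lemma channelSide_mono {h h' e a c : ℝ × ℝ} {b₁ b₁' b₂ : ℝ} (hh : h ≤ h') (hb : b₁' ≤ b₁) :
    channelSide (h, e, a, (b₁, b₂), c) ≤ channelSide (h', e, a, (b₁', b₂), c) := by
  have h₁ := hh.1
  have h₂ := hh.2
  intro i
  fin_cases i <;> simp [channelSide] <;> linarith

lemma pi_fin_ten_le_iff {f g : Fin 10 → ℝ} : f ≤ g ↔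
    f 0 ≤ g 0 ∧ f 1 ≤ g 1 ∧ f 2 ≤ g 2 ∧ f 3 ≤ g 3 ∧ f 4 ≤ g 4 ∧ f 5 ≤ g 5 ∧ f 6 ≤ g 6 ∧
      f 7 ≤ g 7 ∧ f 8 ≤ g 8 ∧ f 9 ≤ g 9 := by
  simp only [Pi.le_def, Fin.forall_fin_succ, IsEmpty.forall_iff, and_true]
  rfl

variable [Fintype U] [Fintype S₁] [Fintype S₂] [Fintype V₀] [Fintype V₁] [Fintype V₂] [Fintype X]
  [Fintype Y₁] [Fintype Y₂]

/-- The entropies of the sources, and their conditional entropies given `U`, that enter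
`sourceSide`. -/
def sourceEntropies (P : PMF Ω) (u : Ω → U) (s₁ : Ω → S₁) (s₂ : Ω → S₂) : (ℝ × ℝ) × (ℝ × ℝ × ℝ) :=
  ((entropy P s₁, entropy P s₂), condEntropy P s₁ u, condEntropy P s₂ u,
    condEntropy P (pair s₁ s₂) u)

/-- The entropies of the outputs that enter `channelSide`. -/
def channelEntropies (Q : PMF Ω') (v₀ : Ω' → V₀) (v₁ : Ω' → V₁) (v₂ : Ω' → V₂) (x : Ω' → X)
    (y₁ : Ω' → Y₁) (y₂ : Ω' → Y₂) : (ℝ × ℝ) × (ℝ × ℝ) × ((ℝ × ℝ) × (ℝ × ℝ) × (ℝ × ℝ)) :=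
  ((entropy Q y₁, entropy Q y₂),
    (condEntropy Q y₁ (pair (pair v₀ v₂) x), condEntropy Q y₂ (pair (pair v₀ v₁) x)),
    (condEntropy Q y₁ v₀, condEntropy Q y₂ v₀),
    (condEntropy Q y₁ (pair v₀ v₁), condEntropy Q y₂ (pair v₀ v₁)),
    (condEntropy Q y₁ (pair v₀ v₂), condEntropy Q y₂ (pair v₀ v₂)))

lemma dominated_iff (κ : ℝ) (P : PMF Ω) (u : Ω → U) (s₁ : Ω → S₁) (s₂ : Ω → S₂)
    (Q : PMF Ω') (v₀ : Ω' → V₀) (v₁ : Ω' → V₁) (v₂ : Ω' → V₂) (x : Ω' → X)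
    (y₁ : Ω' → Y₁) (y₂ : Ω' → Y₂) :
    Dominated κ P u s₁ s₂ Q v₀ v₁ v₂ x y₁ y₂ ↔
      sourceSide (sourceEntropies P u s₁ s₂) ≤
        κ • channelSide (channelEntropies Q v₀ v₁ v₂ x y₁ y₂) := by
  rw [pi_fin_ten_le_iff]
  simp only [channelSide, channelEntropies, sourceSide, sourceEntropies, Matrix.cons_val,
    LinearMap.coe_mk, AddHom.coe_mk, Pi.smul_apply, smul_eq_mul]
  constructor
  · rintro ⟨h0, h1, h2, h3, h4, h5, h6, h7, h8, h9⟩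
    simp only [mutualInfo_eq, condMutualInfo_eq] at h0 h1 h2 h3 h4 h5 h6 h7 h8 h9
    refine ⟨?_, ?_, ?_, ?_, ?_, ?_, ?_, ?_, ?_, ?_⟩ <;> linarith
  · rintro ⟨h0, h1, h2, h3, h4, h5, h6, h7, h8, h9⟩
    constructor <;> simp only [mutualInfo_eq, condMutualInfo_eq] <;> linarith

lemma channelSide_nonneg (Q : PMF Ω') (v₀ : Ω' → V₀) (v₁ : Ω' → V₁) (v₂ : Ω' → V₂) (x : Ω' → X)
    (y₁ : Ω' → Y₁) (y₂ : Ω' → Y₂) : 0 ≤ channelSide (channelEntropies Q v₀ v₁ v₂ x y₁ y₂) := by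
  have a₁ := mutualInfo_nonneg Q v₀ y₁
  have a₂ := mutualInfo_nonneg Q v₀ y₂
  have b₁ := mutualInfo_nonneg Q (pair v₀ v₁) y₁
  have b₂ := mutualInfo_nonneg Q (pair v₀ v₂) y₂
  have c₁ := condMutualInfo_nonneg Q v₁ y₁ v₀
  have c₂ := condMutualInfo_nonneg Q v₂ y₂ v₀
  have d₁ := condMutualInfo_nonneg Q x y₂ (pair v₀ v₁)
  have d₂ := condMutualInfo_nonneg Q x y₁ (pair v₀ v₂)
  simp only [mutualInfo_eq, condMutualInfo_eq] at a₁ a₂ b₁ b₂ c₁ c₂ d₁ d₂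
  intro i
  fin_cases i <;> simp [channelSide, channelEntropies] <;> linarith

end TenInequalities

section PointSide

variable {Ω V₀ V₁ V₂ X Y₁ Y₂ : Type*} [Fintype X] [Fintype Y₁] [Fintype Y₂]

lemma concaveOn_outEntropies (W : X → PMF (Y₁ × Y₂)) :
    ConcaveOn ℝ (stdSimplex ℝ X) (outEntropies W) :=
  ⟨convex_stdSimplex ℝ X, fun _ hq _ hq' _ _ hs ht hst =>
    ⟨(concaveOn_outEntropy _).2 hq hq' hs ht hst, (concaveOn_outEntropy _).2 hq hq' hs ht hst⟩⟩

/-- The entropies `(H(Y₁|X), H(Y₂|X))`, as a function of the law of `X`. -/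
def noiseEntropies (W : X → PMF (Y₁ × Y₂)) : (X → ℝ) →ₗ[ℝ] ℝ × ℝ :=
  Fintype.linearCombination ℝ fun x => outEntropies W (Pi.single x 1)

/-- The value of `channelSide` determined by the law of `X` and the conditional entropies of the
outputs given `V₀`, given `(V₀, V₁)` and given `(V₀, V₂)`. -/
def pointSide (W : X → PMF (Y₁ × Y₂)) (p : (X → ℝ) × (ℝ × ℝ) × (ℝ × ℝ) × (ℝ × ℝ)) : Fin 10 → ℝ :=
  channelSide (outEntropies W p.1, noiseEntropies W p.1, p.2)

lemma continuous_pointSide (W : X → PMF (Y₁ × Y₂)) : Continuous (pointSide W) := by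
  have hnoise := (noiseEntropies W).continuous_of_finiteDimensional
  exact channelSide.continuous_of_finiteDimensional.comp
    (((continuous_outEntropies W).comp continuous_fst).prodMk
      ((hnoise.comp continuous_fst).prodMk continuous_snd))

lemma concaveOn_pointSide (W : X → PMF (Y₁ × Y₂)) :
    ConcaveOn ℝ (stdSimplex ℝ X ×ˢ Set.univ) (pointSide W) := by
  refine ⟨(convex_stdSimplex ℝ X).prod convex_univ, fun p hp p' hp' s t hs ht hst => ?_⟩
  have houtput := (concaveOn_outEntropies W).2 hp.1 hp'.1 hs ht hst
  simp only [pointSide, ← map_smul, ← map_add, Prod.smul_mk, Prod.mk_add_mk] at houtput ⊢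
  exact channelSide_mono houtput le_rfl

lemma pointSide_mono (W : X → PMF (Y₁ × Y₂)) {q : X → ℝ} {a b c : ℝ × ℝ} {b₁ : ℝ} (h : b₁ ≤ b.1) :
    pointSide W (q, a, b, c) ≤ pointSide W (q, a, (b₁, b.2), c) :=
  channelSide_mono le_rfl h

variable [Fintype V₀] [Fintype V₁] [Fintype V₂] {P : PMF Ω} {v₀ : Ω → V₀} {v₁ : Ω → V₁}
  {v₂ : Ω → V₂} {x : Ω → X} {y₁ : Ω → Y₁} {y₂ : Ω → Y₂} {W : X → PMF (Y₁ × Y₂)}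

lemma IsMarkov.condEntropies_eq {V : Type*} [Fintype V] {v : Ω → V}
    (h : IsMarkov P v x (pair y₁ y₂) W) :
    (condEntropy P y₁ v, condEntropy P y₂ v) = ∑ a, outEntropies W (jointArray P v x a) := by
  simp only [Prod.ext_iff, Prod.fst_sum, Prod.snd_sum]
  exact ⟨(h.comp_output Prod.fst).condEntropy_eq, (h.comp_output Prod.snd).condEntropy_eq⟩

lemma IsMarkov.arrayPoint_jointArray (h : IsMarkov P (pair v₀ (pair v₁ v₂)) x (pair y₁ y₂) W) :
    arrayPoint (outEntropies W) (jointArray P (pair v₀ (pair v₁ v₂)) x) =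
      (prob P x, (channelEntropies P v₀ v₁ v₂ x y₁ y₂).2.2) := by
  have h₀ : IsMarkov P v₀ x (pair y₁ y₂) W := h.comp fun v _ => v.1
  have h₁ : IsMarkov P (pair v₀ v₁) x (pair y₁ y₂) W := h.comp fun v _ => (v.1, v.2.1)
  have h₂ : IsMarkov P (pair v₀ v₂) x (pair y₁ y₂) W := h.comp fun v _ => (v.1, v.2.2)
  set r := jointArray P (pair v₀ (pair v₁ v₂)) x with hr
  have hr₀ (i : V₀) : jointArray P v₀ x i = ∑ j, ∑ k, r (i, j, k) := by
    refine (jointArray_comp P (pair v₀ (pair v₁ v₂)) x (fun v => v.1) i).trans ?_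
    simpa [Fintype.sum_prod_type_right, hr] using Finset.sum_comm
  have hr₁ (i : V₀) (j : V₁) : jointArray P (pair v₀ v₁) x (i, j) = ∑ k, r (i, j, k) := by
    refine (jointArray_comp P (pair v₀ (pair v₁ v₂)) x (fun v => (v.1, v.2.1)) (i, j)).trans ?_
    simp [Fintype.sum_prod_type_right, ite_and, hr]
  have hr₂ (i : V₀) (k : V₂) : jointArray P (pair v₀ v₂) x (i, k) = ∑ j, r (i, j, k) := by
    refine (jointArray_comp P (pair v₀ (pair v₁ v₂)) x (fun v => (v.1, v.2.2)) (i, k)).trans ?_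
    simp [Fintype.sum_prod_type, ite_and, hr]
  simp only [channelEntropies, h₀.condEntropies_eq, h₁.condEntropies_eq, h₂.condEntropies_eq,
    Fintype.sum_prod_type, hr₀, hr₁, hr₂, arrayPoint,
    ← sum_jointArray P (pair v₀ (pair v₁ v₂)) x]
  rfl

lemma IsMarkov.channelSide_eq_pointSide
    (h : IsMarkov P (pair v₀ (pair v₁ v₂)) x (pair y₁ y₂) W) :
    channelSide (channelEntropies P v₀ v₁ v₂ x y₁ y₂) =
      pointSide W (arrayPoint (outEntropies W) (jointArray P (pair v₀ (pair v₁ v₂)) x)) := by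
  have hout : (entropy P y₁, entropy P y₂) = outEntropies W (prob P x) :=
    Prod.ext (h.comp_output Prod.fst).entropy_eq (h.comp_output Prod.snd).entropy_eq
  have h₁ : IsMarkov P (pair v₀ v₁) x (pair y₁ y₂) W := h.comp fun v _ => (v.1, v.2.1)
  have h₂ : IsMarkov P (pair v₀ v₂) x (pair y₁ y₂) W := h.comp fun v _ => (v.1, v.2.2)
  have hnoise : (condEntropy P y₁ (pair (pair v₀ v₂) x),
      condEntropy P y₂ (pair (pair v₀ v₁) x)) = noiseEntropies W (prob P x) := by
    simp only [noiseEntropies, Fintype.linearCombination_apply, Prod.ext_iff, Prod.fst_sum,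
      Prod.snd_sum]
    exact ⟨(h₂.comp_output Prod.fst).condEntropy_pair_input,
      (h₁.comp_output Prod.snd).condEntropy_pair_input⟩
  rw [h.arrayPoint_jointArray, pointSide, ← hout, ← hnoise]
  rfl

lemma pointSide_inputArray (W : X → PMF (Y₁ × Y₂)) (pX : PMF X) (pV : X → PMF (V₀ × V₁ × V₂)) :
    pointSide W (arrayPoint (outEntropies W) (inputArray pX pV)) =
      channelSide (channelEntropies (channelJoint pX pV W) (fun ω => ω.1.1) (fun ω => ω.1.2.1)
        (fun ω => ω.1.2.2) (fun ω => ω.2.1) (fun ω => ω.2.2.1) (fun ω => ω.2.2.2)) := by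
  rw [← jointArray_channelJoint pX pV W]
  exact (isMarkov_channelJoint pX pV W).channelSide_eq_pointSide.symm

lemma pointSide_inputArray_nonneg (W : X → PMF (Y₁ × Y₂)) (pX : PMF X)
    (pV : X → PMF (V₀ × V₁ × V₂)) :
    0 ≤ pointSide W (arrayPoint (outEntropies W) (inputArray pX pV)) := by
  rw [pointSide_inputArray]
  exact channelSide_nonneg _ _ _ _ _ _ _

end PointSide

section Alphabets

variable {U V₀ V₁ V₂ S₁ S₂ X Y₁ Y₂ : Type*} [Fintype U] [Fintype V₀] [Fintype V₁] [Fintype V₂]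
  [Fintype S₁] [Fintype S₂] [Fintype X] [Fintype Y₁] [Fintype Y₂]

/-- The contributions to `H(S₁|U)`, `H(S₂|U)` and `H(S₁,S₂|U)` of a letter `u` with
`q s = Pr(U = u, (S₁, S₂) = s)`. -/
def sourcePart (q : S₁ × S₂ → ℝ) : ℝ × ℝ × ℝ :=
  (outEntropy (outputMap PMF.pure Prod.fst) q, outEntropy (outputMap PMF.pure Prod.snd) q,
    outEntropy PMF.pure q)

lemma posHomogeneous_sourcePart : PosHomogeneous (sourcePart (S₁ := S₁) (S₂ := S₂)) :=
  fun c _ q => by simp only [sourcePart, outEntropy_smul, Prod.smul_mk, smul_eq_mul]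

/-- The `sourceEntropies` of the source `p` and a variable `U` with `A u s = Pr(U = u, S = s)`. -/
def sourcePoint (p : PMF (S₁ × S₂)) (A : U → S₁ × S₂ → ℝ) : (ℝ × ℝ) × (ℝ × ℝ × ℝ) :=
  ((entropy p Prod.fst, entropy p Prod.snd), ∑ u, sourcePart (A u))

lemma sourceEntropies_sourceJoint (p : PMF (S₁ × S₂)) (pU : S₁ × S₂ → PMF U) :
    sourceEntropies (sourceJoint p pU) (fun ω => ω.1) (fun ω => ω.2.1) (fun ω => ω.2.2) =
      sourcePoint p (inputArray p pU) := by
  have hM := isMarkov_pure (sourceJoint p pU) (fun ω => ω.1) (fun ω => ω.2)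
  have h₁ := (hM.comp_output Prod.fst).condEntropy_eq
  have h₂ := (hM.comp_output Prod.snd).condEntropy_eq
  have h₁₂ := hM.condEntropy_eq
  rw [jointArray_sourceJoint] at h₁ h₂ h₁₂
  simp only [sourceEntropies, sourcePoint, sourcePart, Prod.ext_iff, Prod.fst_sum, Prod.snd_sum]
  exact ⟨⟨entropy_sourceJoint p pU Prod.fst, entropy_sourceJoint p pU Prod.snd⟩, h₁, h₂, h₁₂⟩

lemma boundHolds_iff (κ : ℝ) (p : PMF (S₁ × S₂)) (W : X → PMF (Y₁ × Y₂)) (pX : PMF X)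
    (pU : S₁ × S₂ → PMF U) (pV : X → PMF (V₀ × V₁ × V₂)) :
    BoundHolds κ p W pX pU pV ↔ sourceSide (sourcePoint p (inputArray p pU)) ≤
      κ • pointSide W (arrayPoint (outEntropies W) (inputArray pX pV)) := by
  rw [pointSide_inputArray, ← sourceEntropies_sourceJoint]
  exact dominated_iff κ _ _ _ _ _ _ _ _ _ _ _

lemma exists_test_of_mem_hull_atoms (W : X → PMF (Y₁ × Y₂)) (pX : PMF X)
    {z : (ℝ × ℝ) × (ℝ × ℝ) × (ℝ × ℝ)}
    (hz : (fun x => (pX x).toReal, z) ∈ PointedCone.hull ℝ (atoms (outEntropies W))) :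
    ∃ pV : X → PMF (Fin (Fintype.card X + 5) × Fin (Fintype.card X) × Fin (Fintype.card X)),
      pointSide W (fun x => (pX x).toReal, z) ≤
        pointSide W (arrayPoint (outEntropies W) (inputArray pX pV)) := by
  obtain ⟨a, b, c⟩ := z
  obtain ⟨r, b₁, hb, hr, hpoint⟩ :=
    exists_array_of_mem_hull_atoms (posHomogeneous_outEntropies W) hz
  have hsum : ∑ v, r v = fun x => (pX x).toReal := by
    simpa only [arrayPoint, Fintype.sum_prod_type] using congrArg Prod.fst hpoint
  obtain ⟨pV, rfl⟩ := exists_inputArray_eq hr hsum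
  exact ⟨pV, hpoint ▸ pointSide_mono W hb⟩

lemma arrayPoint_inputArray_fst (W : X → PMF (Y₁ × Y₂)) (pX : PMF X)
    (pV : X → PMF (V₀ × V₁ × V₂)) :
    (arrayPoint (outEntropies W) (inputArray pX pV)).1 = fun x => (pX x).toReal := by
  rw [← sum_inputArray pX pV]
  simp only [arrayPoint, Fintype.sum_prod_type]

/-- The values of `(H(S₁|U), H(S₂|U), H(S₁,S₂|U))` for which the inequalities hold at a conic
combination of atoms. -/
def feasibleSet (κ : ℝ) (p : PMF (S₁ × S₂)) (W : X → PMF (Y₁ × Y₂)) (pX : PMF X) :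
    Set (ℝ × ℝ × ℝ) :=
  {a | ∃ z, (fun x => (pX x).toReal, z) ∈ PointedCone.hull ℝ (atoms (outEntropies W)) ∧
    sourceSide ((entropy p Prod.fst, entropy p Prod.snd), a) ≤
      κ • pointSide W (fun x => (pX x).toReal, z)}

lemma prodMk_combo {E F : Type*} [AddCommGroup E] [Module ℝ E] [AddCommGroup F] [Module ℝ F]
    {s t : ℝ} (hst : s + t = 1) (k : E) (b b' : F) :
    (k, s • b + t • b') = s • (k, b) + t • (k, b') := by
  rw [Prod.smul_mk, Prod.smul_mk, Prod.mk_add_mk, Convex.combo_self hst]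

lemma convex_feasibleSet {κ : ℝ} (hκ : 0 ≤ κ) (p : PMF (S₁ × S₂)) (W : X → PMF (Y₁ × Y₂))
    (pX : PMF X) : Convex ℝ (feasibleSet κ p W pX) := by
  rintro a ⟨z, hz, ha⟩ a' ⟨z', hz', ha'⟩ s t hs ht hst
  refine ⟨s • z + t • z', ?_, ?_⟩ <;> rw [prodMk_combo hst]
  · exact PointedCone.convex _ hz hz' hs ht hst
  · have hmem (z : (ℝ × ℝ) × (ℝ × ℝ) × (ℝ × ℝ)) :
        (fun x => (pX x).toReal, z) ∈ stdSimplex ℝ X ×ˢ Set.univ :=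
      ⟨toReal_mem_stdSimplex pX, trivial⟩
    rw [prodMk_combo hst, map_add, map_smul, map_smul]
    calc
      _ ≤ s • κ • pointSide W (_, z) + t • κ • pointSide W (_, z') := by gcongr
      _ = κ • (s • pointSide W (_, z) + t • pointSide W (_, z')) := by module
      _ ≤ _ := smul_le_smul_of_nonneg_left
        ((concaveOn_pointSide W).2 (hmem z) (hmem z') hs ht hst) hκ

lemma sum_sourcePart_mem_feasibleSet {κ : ℝ} {p : PMF (S₁ × S₂)} {W : X → PMF (Y₁ × Y₂)}
    {pX : PMF X} {pU : S₁ × S₂ → PMF U} {pV : X → PMF (V₀ × V₁ × V₂)}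
    (h : BoundHolds κ p W pX pU pV) :
    ∑ u, sourcePart (inputArray p pU u) ∈ feasibleSet κ p W pX := by
  rw [boundHolds_iff] at h
  have hmem := arrayPoint_mem_hull_atoms (posHomogeneous_outEntropies W) (inputArray_nonneg pX pV)
  rw [← Prod.mk.eta (p := arrayPoint _ _), arrayPoint_inputArray_fst] at h hmem
  exact ⟨_, hmem, h⟩

theorem exists_bounded_test (p : PMF (S₁ × S₂)) (W : X → PMF (Y₁ × Y₂)) {κ : ℝ} (hκ : 0 ≤ κ)
    (pX : PMF X)
    (h : ∀ (U : Type w) [Fintype U], Fintype.card U ≤ Fintype.card S₁ * Fintype.card S₂ →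
        ∀ pU : S₁ × S₂ → PMF U,
          ∃ (V₀ V₁ V₂ : Type w) (_ : Fintype V₀) (_ : Fintype V₁) (_ : Fintype V₂)
            (pV : X → PMF (V₀ × V₁ × V₂)), BoundHolds κ p W pX pU pV)
    (pU : S₁ × S₂ → PMF U) :
    ∃ pV : X → PMF (Fin (Fintype.card X + 5) × Fin (Fintype.card X) × Fin (Fintype.card X)),
      BoundHolds κ p W pX pU pV := by
  have hfeasible : splitValues LinearMap.id sourcePart (Set.Ici 0)
      (Fintype.card S₁ * Fintype.card S₂) (∑ u, inputArray p pU u) ⊆ feasibleSet κ p W pX := by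
    rintro _ ⟨A, hA, hsum, rfl⟩
    obtain ⟨pU', hpU'⟩ := exists_inputArray_eq (pX := p)
      (r := fun u : ULift.{w} (Fin (Fintype.card S₁ * Fintype.card S₂)) => A u.down)
      (fun u => hA u.down)
      ((Equiv.ulift.sum_comp A).trans (hsum.trans (sum_inputArray p pU)))
    obtain ⟨V₀, V₁, V₂, _, _, _, pV, hbound⟩ := h _ (by simp) pU'
    have hmem := sum_sourcePart_mem_feasibleSet hbound
    rw [hpU'] at hmem
    exact Equiv.ulift.sum_comp (fun i => sourcePart (A i)) ▸ hmem
  have hdim : Module.finrank ℝ (S₁ × S₂ → ℝ) ≤ Fintype.card S₁ * Fintype.card S₂ := by simp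
  obtain ⟨z, hz, hbound⟩ := convexHull_min hfeasible (convex_feasibleSet hκ p W pX)
    (isSalient_nonneg.sum_mem_convexHull_splitValues posHomogeneous_sourcePart hdim
      (inputArray_nonneg p pU))
  obtain ⟨pV, hpV⟩ := exists_test_of_mem_hull_atoms W pX hz
  exact ⟨pV, (boundHolds_iff κ p W pX pU pV).2
    (hbound.trans (smul_le_smul_of_nonneg_left hpV hκ))⟩

end Alphabets

section CommonPart

variable {Ω Ω' α S₁ S₂ T V₀ V₁ V₂ X Y₁ Y₂ : Type*}

lemma entropy_congr_support [Fintype α] (P : PMF Ω) {A A' : Ω → α}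
    (h : ∀ ω ∈ P.support, A ω = A' ω) : entropy P A = entropy P A' := by
  have hmap : P.map A = P.map A' := by
    refine PMF.ext fun a => ?_
    rw [PMF.map_apply, PMF.map_apply]
    refine tsum_congr fun ω => ?_
    by_cases hω : ω ∈ P.support
    · rw [h ω hω]
    · rw [(PMF.apply_eq_zero_iff P ω).2 hω, ite_self, ite_self]
  simp only [entropy, prob, hmap]

variable [Fintype S₁] [Fintype S₂] [Fintype T] [Fintype V₀] [Fintype V₁] [Fintype V₂] [Fintype X]
  [Fintype Y₁] [Fintype Y₂]

lemma condEntropy_eq_sub_of_ae_comp {P : PMF Ω} {u : Ω → T} {s : Ω → S₁} (φ : S₁ → T)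
    (h : ∀ ω ∈ P.support, u ω = φ (s ω)) : condEntropy P s u = entropy P s - entropy P u := by
  have hpair : entropy P (pair s u) = entropy P (pair s fun ω => φ (s ω)) :=
    entropy_congr_support P fun ω hω => Prod.ext rfl (h ω hω)
  rw [condEntropy_eq, hpair, entropy_congr P (B := s)]
  exact fun ω ω' => ⟨fun hs => (Prod.mk.inj hs).1, fun hs => by simp only [pair, hs]⟩

lemma mutualInfo_pair (P : PMF Ω) (v₀ : Ω → V₀) (v₁ : Ω → V₁) (y : Ω → Y₁) :
    mutualInfo P (pair v₀ v₁) y = mutualInfo P v₀ y + condMutualInfo P v₁ y v₀ := by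
  simp only [mutualInfo_eq, condMutualInfo_eq]
  ring

theorem dominated_iff_gohariAnantharam {κ : ℝ} (hκ : 0 ≤ κ) {P : PMF Ω} {u : Ω → T}
    {s₁ : Ω → S₁} {s₂ : Ω → S₂} (φ₁ : S₁ → T) (φ₂ : S₂ → T)
    (h₁ : ∀ ω ∈ P.support, u ω = φ₁ (s₁ ω)) (h₂ : ∀ ω ∈ P.support, u ω = φ₂ (s₂ ω)) (Q : PMF Ω')
    (v₀ : Ω' → V₀) (v₁ : Ω' → V₁) (v₂ : Ω' → V₂) (x : Ω' → X) (y₁ : Ω' → Y₁) (y₂ : Ω' → Y₂) :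
    Dominated κ P u s₁ s₂ Q v₀ v₁ v₂ x y₁ y₂ ↔
      GohariAnantharam κ P u s₁ s₂ Q v₀ v₁ v₂ x y₁ y₂ := by
  have hs₁ := condEntropy_eq_sub_of_ae_comp φ₁ h₁
  have hs₂ := condEntropy_eq_sub_of_ae_comp φ₂ h₂
  have hs := condEntropy_eq_sub_of_ae_comp (s := pair s₁ s₂) (fun s => φ₁ s.1) h₁
  have hmin := mul_min_of_nonneg (mutualInfo Q v₀ y₁) (mutualInfo Q v₀ y₂) hκ
  have hmin₁ := hmin.trans_le (min_le_left _ _)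
  have hmin₂ := hmin.trans_le (min_le_right _ _)
  constructor
  · rintro ⟨common₁, common₂, single₁, single₂, cross₁, cross₂, total₁, total₂, chain₁, chain₂⟩
    simp only [mutualInfo_pair Q, mutualInfo_eq P, hs₁, hs₂, hs] at *
    rcases min_choice (κ * mutualInfo Q v₀ y₁) (κ * mutualInfo Q v₀ y₂) with h | h <;>
      constructor <;> linarith
  · rintro ⟨common, single₁, single₂, total₁, total₂⟩
    constructor <;> simp only [mutualInfo_pair Q, mutualInfo_eq P, hs₁, hs₂, hs] <;> linarith

theorem boundHolds_iff_gohariAnantharamHolds (p : PMF (S₁ × S₂)) (W : X → PMF (Y₁ × Y₂)) {κ : ℝ}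
    (hκ : 0 ≤ κ) {φ₁ : S₁ → T} {φ₂ : S₂ → T} (h : ∀ s ∈ p.support, φ₁ s.1 = φ₂ s.2) (pX : PMF X)
    (pV : X → PMF (V₀ × V₁ × V₂)) :
    BoundHolds κ p W pX (fun s => PMF.pure (φ₁ s.1)) pV ↔
      GohariAnantharamHolds κ p W pX φ₁ pV := by
  have hmap : sourceJoint p (fun s => PMF.pure (φ₁ s.1)) = p.map fun s => (φ₁ s.1, s) := by
    simp only [sourceJoint, PMF.pure_map]
    rfl
  have hU₁ : ∀ ω ∈ (p.map fun s => (φ₁ s.1, s)).support, ω.1 = φ₁ ω.2.1 := by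
    simp only [PMF.support_map]
    rintro _ ⟨s, -, rfl⟩
    rfl
  have hU₂ : ∀ ω ∈ (p.map fun s => (φ₁ s.1, s)).support, ω.1 = φ₂ ω.2.2 := by
    simp only [PMF.support_map]
    rintro _ ⟨s, hs, rfl⟩
    exact h s hs
  rw [BoundHolds, hmap, dominated_iff_gohariAnantharam hκ φ₁ φ₂ hU₁ hU₂]
  have hu := entropy_map p (fun s => (φ₁ s.1, s)) (fun ω => ω.1)
  have hs₁ := entropy_map p (fun s => (φ₁ s.1, s)) (fun ω => ω.2.1)
  have hs₂ := entropy_map p (fun s => (φ₁ s.1, s)) (fun ω => ω.2.2)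
  have hs := entropy_map p (fun s => (φ₁ s.1, s)) (pair (fun ω => ω.2.1) fun ω => ω.2.2)
  constructor <;> rintro ⟨common, single₁, single₂, total₁, total₂⟩
  · exact ⟨hu.ge.trans common, hs₁.ge.trans single₁, hs₂.ge.trans single₂, hs.ge.trans total₁,
      hs.ge.trans total₂⟩
  · exact ⟨hu.le.trans common, hs₁.le.trans single₁, hs₂.le.trans single₂, hs.le.trans total₁,
      hs.le.trans total₂⟩

end CommonPart

section Blocks

variable {Ω ι Y : Type*}

/-- The entries of a sequence of random variables whose indices lie in `T`, as one random
variable; the other entries are replaced by `none`. -/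
def entries (y : ι → Ω → Y) (T : Set ι) : Ω → ι → Option Y :=
  fun ω i => if i ∈ T then some (y i ω) else none

lemma entries_eq_iff {y : ι → Ω → Y} {T : Set ι} {ω ω' : Ω} :
    entries y T ω = entries y T ω' ↔ ∀ i ∈ T, y i ω = y i ω' := by
  rw [funext_iff]
  refine forall_congr' fun i => ?_
  by_cases hi : i ∈ T <;> simp [entries, hi]

/-- A sequence of random variables, as one random variable. -/
def block (y : ι → Ω → Y) : Ω → ι → Y := fun ω t => y t ω

variable {α Y₁ Y₂ : Type*} {n : ℕ}

/-- The entries of `y₁` before time `t` together with those of `y₂` after time `t`. -/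
def blockGap (y₁ : Fin n → Ω → Y₁) (y₂ : Fin n → Ω → Y₂) (t : Fin n) :
    Ω → (Fin n → Option Y₁) × (Fin n → Option Y₂) :=
  pair (entries y₁ (Set.Iio t)) (entries y₂ (Set.Ioi t))

lemma blockGap_eq_iff {y₁ : Fin n → Ω → Y₁} {y₂ : Fin n → Ω → Y₂} {t : Fin n} {ω ω' : Ω} :
    blockGap y₁ y₂ t ω = blockGap y₁ y₂ t ω' ↔
      (∀ i < t, y₁ i ω = y₁ i ω') ∧ ∀ i > t, y₂ i ω = y₂ i ω' := by
  simp only [blockGap, pair, Prod.mk.injEq, entries_eq_iff, Set.mem_Iio, Set.mem_Ioi, gt_iff_lt]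

/-- The first `k` entries of `y₁` together with the entries of `y₂` from index `k` on. -/
def blockSplice (y₁ : Fin n → Ω → Y₁) (y₂ : Fin n → Ω → Y₂) (k : ℕ) :
    Ω → (Fin n → Option Y₁) × (Fin n → Option Y₂) :=
  pair (entries y₁ {i | (i : ℕ) < k}) (entries y₂ {i | k ≤ (i : ℕ)})

lemma blockSplice_eq_iff {y₁ : Fin n → Ω → Y₁} {y₂ : Fin n → Ω → Y₂} {k : ℕ} {ω ω' : Ω} :
    blockSplice y₁ y₂ k ω = blockSplice y₁ y₂ k ω' ↔
      (∀ i : Fin n, (i : ℕ) < k → y₁ i ω = y₁ i ω') ∧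
        ∀ i : Fin n, k ≤ (i : ℕ) → y₂ i ω = y₂ i ω' := by
  simp only [blockSplice, pair, Prod.mk.injEq, entries_eq_iff, Set.mem_ofPred_eq]

lemma blockSplice_castSucc_eq_iff {y₁ : Fin n → Ω → Y₁} {y₂ : Fin n → Ω → Y₂} {t : Fin n}
    {ω ω' : Ω} : blockSplice y₁ y₂ t ω = blockSplice y₁ y₂ t ω' ↔
      y₂ t ω = y₂ t ω' ∧ blockGap y₁ y₂ t ω = blockGap y₁ y₂ t ω' := by
  simp only [blockSplice_eq_iff, blockGap_eq_iff, Fin.val_fin_lt, Fin.val_fin_le,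
    le_iff_eq_or_lt (α := Fin n), or_imp, forall_and, forall_eq', gt_iff_lt]
  tauto

lemma blockSplice_succ_eq_iff {y₁ : Fin n → Ω → Y₁} {y₂ : Fin n → Ω → Y₂} {t : Fin n}
    {ω ω' : Ω} : blockSplice y₁ y₂ (t + 1) ω = blockSplice y₁ y₂ (t + 1) ω' ↔
      y₁ t ω = y₁ t ω' ∧ blockGap y₁ y₂ t ω = blockGap y₁ y₂ t ω' := by
  simp only [blockSplice_eq_iff, blockGap_eq_iff, Order.lt_add_one_iff, Order.add_one_le_iff,
    Fin.val_fin_lt, Fin.val_fin_le, le_iff_eq_or_lt (α := Fin n), or_imp, forall_and, forall_eq,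
    gt_iff_lt]
  tauto

variable [Fintype α] [Fintype Y₁] [Fintype Y₂]

lemma condEntropy_sub_condEntropy_blockGap (P : PMF Ω) (y₁ : Fin n → Ω → Y₁)
    (y₂ : Fin n → Ω → Y₂) (A : Ω → α) (t : Fin n) :
    condEntropy P (y₁ t) (pair A (blockGap y₁ y₂ t)) -
        condEntropy P (y₂ t) (pair A (blockGap y₁ y₂ t)) =
      entropy P (pair A (blockSplice y₁ y₂ (t + 1))) -
        entropy P (pair A (blockSplice y₁ y₂ t)) := by
  have h₁ : entropy P (pair (y₁ t) (pair A (blockGap y₁ y₂ t))) =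
      entropy P (pair A (blockSplice y₁ y₂ (t + 1))) := entropy_congr P fun ω ω' => by
    simp only [pair, Prod.mk.injEq, blockSplice_succ_eq_iff]; tauto
  have h₂ : entropy P (pair (y₂ t) (pair A (blockGap y₁ y₂ t))) =
      entropy P (pair A (blockSplice y₁ y₂ t)) := entropy_congr P fun ω ω' => by
    simp only [pair, Prod.mk.injEq, blockSplice_castSucc_eq_iff]; tauto
  rw [condEntropy_eq, condEntropy_eq, h₁, h₂]
  ring

/-- Csiszár's sum identity, in terms of conditional entropies. -/
lemma condEntropy_block_sub_condEntropy_block (P : PMF Ω) (y₁ : Fin n → Ω → Y₁)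
    (y₂ : Fin n → Ω → Y₂) (A : Ω → α) :
    condEntropy P (block y₁) A - condEntropy P (block y₂) A =
      ∑ t, (condEntropy P (y₁ t) (pair A (blockGap y₁ y₂ t)) -
        condEntropy P (y₂ t) (pair A (blockGap y₁ y₂ t))) := by
  have hlast : entropy P (pair (block y₁) A) = entropy P (pair A (blockSplice y₁ y₂ n)) :=
    entropy_congr P fun ω ω' => by
      simp [pair, block, blockSplice_eq_iff, funext_iff, and_comm]
  have hfirst : entropy P (pair (block y₂) A) = entropy P (pair A (blockSplice y₁ y₂ 0)) :=
    entropy_congr P fun ω ω' => by simp [pair, block, blockSplice_eq_iff, funext_iff, and_comm]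
  simp_rw [condEntropy_sub_condEntropy_blockGap]
  rw [Fin.sum_univ_eq_sum_range (fun k => entropy P (pair A (blockSplice y₁ y₂ (k + 1))) -
    entropy P (pair A (blockSplice y₁ y₂ k))) n,
    Finset.sum_range_sub (fun k => entropy P (pair A (blockSplice y₁ y₂ k))),
    condEntropy_eq, condEntropy_eq, hlast, hfirst]
  ring

-- This is Csiszár's sum identity with a constant second sequence.
lemma condEntropy_block (P : PMF Ω) (y : Fin n → Ω → Y₁) (A : Ω → α) :
    condEntropy P (block y) A =
      ∑ t, condEntropy P (y t) (pair A (blockGap y (fun _ _ => ()) t)) := by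
  simpa only [condEntropy_eq_zero, sub_zero] using
    condEntropy_block_sub_condEntropy_block P y (fun _ _ => ()) A

lemma sum_condEntropy_blockGap_le (P : PMF Ω) (y₁ : Fin n → Ω → Y₁) (y₂ : Fin n → Ω → Y₂)
    (A : Ω → α) :
    ∑ t, condEntropy P (y₁ t) (pair A (blockGap y₁ y₂ t)) ≤ condEntropy P (block y₁) A := by
  rw [condEntropy_block]
  refine Finset.sum_le_sum fun t _ => condEntropy_mono P _ fun ω ω' h => ?_
  simp only [pair, Prod.mk.injEq, blockGap_eq_iff] at h ⊢
  exact ⟨h.1, h.2.1, fun _ _ => trivial⟩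

lemma sum_condEntropy_blockGap_le' (P : PMF Ω) (y₁ : Fin n → Ω → Y₁) (y₂ : Fin n → Ω → Y₂)
    (A : Ω → α) :
    ∑ t, condEntropy P (y₂ t) (pair A (blockGap y₁ y₂ t)) ≤ condEntropy P (block y₂) A := by
  have hcsiszar := condEntropy_block_sub_condEntropy_block P y₁ y₂ A
  have hle := sum_condEntropy_blockGap_le P y₁ y₂ A
  rw [Finset.sum_sub_distrib] at hcsiszar
  linarith

lemma entropy_block_le (P : PMF Ω) (y : Fin n → Ω → Y₁) :
    entropy P (block y) ≤ ∑ t, entropy P (y t) := by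
  rw [← condEntropy_of_subsingleton P (block y) fun _ => (), condEntropy_block]
  exact Finset.sum_le_sum fun t _ => condEntropy_le_entropy _ _ _

end Blocks

section SingleLetterization

variable {Ω α β γ δ : Type*} [Fintype α] [Fintype β] [Fintype γ] [Fintype δ]

lemma condEntropy_pair (P : PMF Ω) (A : Ω → α) (B : Ω → β) (C : Ω → γ) :
    condEntropy P (pair A B) C = condEntropy P A C + condEntropy P B (pair C A) := by
  have h : entropy P (pair (pair A B) C) = entropy P (pair B (pair C A)) :=
    entropy_congr P fun ω ω' => by simp only [pair, Prod.mk.injEq]; tauto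
  rw [condEntropy_eq, condEntropy_eq, condEntropy_eq, h, entropy_pair_comm P C A]
  ring

lemma condEntropy_pair_comm (P : PMF Ω) (A : Ω → α) (B : Ω → β) (C : Ω → γ) :
    condEntropy P (pair A B) C = condEntropy P (pair B A) C :=
  condEntropy_congr P (fun _ _ => by simp only [pair, Prod.mk.injEq, and_comm]) fun _ _ => Iff.rfl

lemma condEntropy_pair_right_comm (P : PMF Ω) (A : Ω → α) (B : Ω → β) (C : Ω → γ) (D : Ω → δ) :
    condEntropy P A (pair (pair B C) D) = condEntropy P A (pair (pair B D) C) :=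
  condEntropy_congr P (fun _ _ => Iff.rfl) fun _ _ => by
    simp only [pair, Prod.mk.injEq, and_right_comm]

lemma condEntropy_add_condEntropy_le (P : PMF Ω) (B : Ω → β) (C : Ω → γ) (Z : Ω → δ) :
    condEntropy P B C + condEntropy P Z (pair C B) ≤ condEntropy P Z C + condEntropy P B Z := by
  rw [← condEntropy_pair, condEntropy_pair_comm, condEntropy_pair]
  exact add_le_add_right (condEntropy_pair_le P B C Z) _

lemma entropy_add_condEntropy_comm (P : PMF Ω) (A : Ω → α) (B : Ω → β) :
    entropy P A + condEntropy P B A = entropy P B + condEntropy P A B := by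
  rw [condEntropy_eq, condEntropy_eq, entropy_pair_comm P A B]
  ring

lemma mutualInfo_le_mutualInfo_add_condEntropy (P : PMF Ω) (A : Ω → α) (B : Ω → β) (Z : Ω → γ) :
    mutualInfo P A B ≤ mutualInfo P A Z + condEntropy P B Z := by
  have hchain := condEntropy_add_condEntropy_le P Z A B
  have hnonneg := condEntropy_nonneg P B (pair A Z)
  have hcomm := entropy_add_condEntropy_comm P Z B
  rw [mutualInfo_eq, mutualInfo_eq]
  linarith

variable {U₀ U₁ U₂ X Y₁ Y₂ : Type*} [Fintype U₀] [Fintype U₁] [Fintype U₂] [Fintype X]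
  [Fintype Y₁] [Fintype Y₂]

-- Sources that are nearly determined by the outputs `y₁` and `y₂` satisfy the ten inequalities
-- up to an error, with themselves as auxiliary variables and as channel input.
lemma sourceSide_le_channelSide_add (P : PMF Ω) (w₀ : Ω → U₀) (w₁ : Ω → U₁) (w₂ : Ω → U₂)
    (y₁ : Ω → Y₁) (y₂ : Ω → Y₂) {Δ : ℝ} (h₁ : condEntropy P w₁ y₁ ≤ Δ)
    (h₂ : condEntropy P w₂ y₂ ≤ Δ) :
    sourceSide (sourceEntropies P w₀ w₁ w₂) ≤
      channelSide (channelEntropies P w₀ w₁ w₂ (pair w₁ w₂) y₁ y₂) + (3 * Δ) • 1 := by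
  have hΔ : 0 ≤ Δ := (condEntropy_nonneg _ _ _).trans h₁
  have hinfo₁ := mutualInfo_le_mutualInfo_add_condEntropy P w₀ w₁ y₁
  have hinfo₂ := mutualInfo_le_mutualInfo_add_condEntropy P w₀ w₂ y₂
  rw [mutualInfo_eq, mutualInfo_eq] at hinfo₁ hinfo₂
  have hcomm₁ := entropy_add_condEntropy_comm P w₁ y₁
  have hcomm₂ := entropy_add_condEntropy_comm P w₂ y₂
  have hdrop₁ := condEntropy_pair_le P y₁ w₀ w₁
  have hdrop₂ := condEntropy_pair_le P y₂ w₀ w₂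
  have hcond₁ := condEntropy_add_condEntropy_le P w₁ w₀ y₁
  have hcond₂ := condEntropy_add_condEntropy_le P w₂ w₀ y₂
  have hnoise₁ := condEntropy_add_condEntropy_le P w₁ (pair w₀ w₂) y₁
  have hnoise₂ := condEntropy_add_condEntropy_le P w₂ (pair w₀ w₁) y₂
  rw [condEntropy_congr P (A' := y₁) (B' := pair (pair w₀ w₂) (pair w₁ w₂))
    (fun _ _ => Iff.rfl) fun _ _ => by simp only [pair, Prod.mk.injEq]; tauto] at hnoise₁
  rw [condEntropy_congr P (A' := y₂) (B' := pair (pair w₀ w₁) (pair w₁ w₂))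
    (fun _ _ => Iff.rfl) fun _ _ => by simp only [pair, Prod.mk.injEq]; tauto] at hnoise₂
  have hchain₁ := condEntropy_pair P w₁ w₂ w₀
  have hchain₂ := (condEntropy_pair_comm P w₁ w₂ w₀).trans (condEntropy_pair P w₂ w₁ w₀)
  intro i
  fin_cases i <;> simp [sourceSide, sourceEntropies, channelSide, channelEntropies] <;> linarith

variable {n : ℕ}

lemma channelSide_block_le (P : PMF Ω) (w₀ : Ω → U₀) (w₁ : Ω → U₁) (w₂ : Ω → U₂)
    (x : Fin n → Ω → X) (y₁ : Fin n → Ω → Y₁) (y₂ : Fin n → Ω → Y₂)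
    (h₁ : ∀ t, condEntropy P (y₁ t) (pair (pair (pair w₀ (blockGap y₁ y₂ t)) w₂) (x t)) ≤
      condEntropy P (y₁ t) (pair (pair (pair w₀ w₂) (pair w₁ w₂)) (blockGap y₁ y₂ t)))
    (h₂ : ∀ t, condEntropy P (y₂ t) (pair (pair (pair w₀ (blockGap y₁ y₂ t)) w₁) (x t)) ≤
      condEntropy P (y₂ t) (pair (pair (pair w₀ w₁) (pair w₁ w₂)) (blockGap y₁ y₂ t))) :
    channelSide (channelEntropies P w₀ w₁ w₂ (pair w₁ w₂) (block y₁) (block y₂)) ≤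
      ∑ t, channelSide (channelEntropies P (pair w₀ (blockGap y₁ y₂ t)) w₁ w₂ (x t) (y₁ t)
        (y₂ t)) := by
  have hout₁ := entropy_block_le P y₁
  have hout₂ := entropy_block_le P y₂
  have hnoise₁ := (Finset.sum_le_sum fun t _ => h₁ t).trans
    (sum_condEntropy_blockGap_le P y₁ y₂ (pair (pair w₀ w₂) (pair w₁ w₂)))
  have hnoise₂ := (Finset.sum_le_sum fun t _ => h₂ t).trans
    (sum_condEntropy_blockGap_le' P y₁ y₂ (pair (pair w₀ w₁) (pair w₁ w₂)))
  have hgap₀ := sum_condEntropy_blockGap_le P y₁ y₂ w₀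
  have hgap₁ := sum_condEntropy_blockGap_le P y₁ y₂ (pair w₀ w₁)
  have hgap₂ := sum_condEntropy_blockGap_le P y₁ y₂ (pair w₀ w₂)
  have hcsiszar₀ := condEntropy_block_sub_condEntropy_block P y₁ y₂ w₀
  have hcsiszar₁ := condEntropy_block_sub_condEntropy_block P y₁ y₂ (pair w₀ w₁)
  have hcsiszar₂ := condEntropy_block_sub_condEntropy_block P y₁ y₂ (pair w₀ w₂)
  simp only [fun t => condEntropy_pair_right_comm P (y₁ t) w₀ w₁ (blockGap y₁ y₂ t),
    fun t => condEntropy_pair_right_comm P (y₂ t) w₀ w₁ (blockGap y₁ y₂ t),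
    Finset.sum_sub_distrib] at hcsiszar₀ hcsiszar₁ hgap₁
  simp only [fun t => condEntropy_pair_right_comm P (y₁ t) w₀ w₂ (blockGap y₁ y₂ t),
    fun t => condEntropy_pair_right_comm P (y₂ t) w₀ w₂ (blockGap y₁ y₂ t),
    Finset.sum_sub_distrib] at hcsiszar₂ hgap₂
  rw [← map_sum]
  intro i
  fin_cases i <;>
    simp [channelSide, channelEntropies, Prod.fst_sum, Prod.snd_sum, Finset.sum_add_distrib] <;>
    linarith

end SingleLetterization

section ProductLaws

variable {α β : Type*} [Fintype α] [Fintype β] {n : ℕ} (q : Fin n → PMF α)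

lemma productPMF_apply (a : Fin n → α) : productPMF q a = ∏ t, q t (a t) := by
  rw [productPMF, PMF.ofFintype_apply]

lemma productPMF_map (A : α → β) :
    (productPMF q).map (fun a t => A (a t)) = productPMF fun t => (q t).map A := by
  ext b
  simp only [PMF.map_apply, tsum_fintype, productPMF_apply, Fintype.prod_sum,
    Finset.prod_ite_zero, Finset.mem_univ, true_imp_iff, funext_iff]

lemma map_update_apply (P : PMF α) (t : Fin n) (y a : Fin n → α) : P.map (update y t) a =
    P (a t) * ∏ j ∈ Finset.univ.erase t, if y j = a j then 1 else 0 := by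
  rw [PMF.map_apply, tsum_fintype, Finset.sum_eq_single (a t)]
  · simp only [Finset.prod_ite_zero]
    simp only [eq_update_iff, Finset.mem_erase, Finset.mem_univ, and_true, true_and,
      Finset.prod_const_one, mul_ite, mul_one, mul_zero, eq_comm, ne_eq]
  · intro c _ hc
    rw [if_neg fun h => hc (by rw [h, update_self])]
  · simp

lemma productPMF_eq_bind_update (t : Fin n) :
    productPMF q = (productPMF q).bind fun y => (q t).map (update y t) := by
  ext a
  rw [PMF.bind_apply, tsum_fintype]
  have hsum (j : Fin n) : ∑ c, q j c = 1 := by rw [← (q j).tsum_coe, tsum_fintype]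
  calc productPMF q a = q t (a t) * ∏ j ∈ Finset.univ.erase t, q j (a j) := by
        rw [productPMF_apply, Finset.mul_prod_erase _ (fun j => q j (a j)) (Finset.mem_univ t)]
    _ = q t (a t) * ∏ j, ∑ c, q j c * if j ≠ t then (if c = a j then 1 else 0) else 1 := by
        rw [← Finset.mul_prod_erase _ _ (Finset.mem_univ t)]
        simp only [ne_eq, not_true_eq_false, if_false, mul_one, hsum, one_mul]
        congr 1
        exact Finset.prod_congr rfl fun j hj => by simp [Finset.ne_of_mem_erase hj]
    _ = ∑ y, productPMF q y * (q t).map (update y t) a := by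
        rw [Fintype.prod_sum, Finset.mul_sum]
        refine Finset.sum_congr rfl fun y _ => ?_
        rw [map_update_apply, productPMF_apply, Finset.prod_mul_distrib, mul_left_comm,
          ← Finset.mul_prod_erase _ (fun j => if j ≠ t then _ else _) (Finset.mem_univ t)]
        simp only [ne_eq, not_true_eq_false, if_false, one_mul]
        congr 2
        exact Finset.prod_congr rfl fun j hj => by simp [Finset.ne_of_mem_erase hj]

lemma productPMF_map_eval (t : Fin n) : (productPMF q).map (fun a => a t) = q t := by
  rw [productPMF_eq_bind_update q t, PMF.map_bind]
  simp only [PMF.map_comp, comp_def, update_self]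
  exact (PMF.bind_const _ _).trans (PMF.map_id _)

lemma entropy_productPMF : entropy (productPMF q) id = ∑ t, entropy (q t) id := by
  have hlog (a : Fin n → α) : prob (productPMF q) id a * (-log (prob (productPMF q) id a)) =
      ∑ t, prob (productPMF q) id a * (-log (prob (q t) id (a t))) := by
    have hprod : prob (productPMF q) id a = ∏ t, prob (q t) id (a t) := by
      simp only [prob, PMF.map_id, productPMF_apply, ENNReal.toReal_prod]
    rcases eq_or_ne (prob (productPMF q) id a) 0 with h0 | h0
    · simp [h0]
    · rw [← Finset.mul_sum, Finset.sum_neg_distrib, ← log_prod, hprod]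
      exact fun t _ => Finset.prod_ne_zero_iff.1 (hprod ▸ h0) t (Finset.mem_univ t)
  rw [entropy_eq_sum, Finset.sum_congr rfl fun a _ => hlog a, Finset.sum_comm]
  refine Finset.sum_congr rfl fun t _ => ?_
  have hmarg : prob (q t) id = prob (productPMF q) fun a => a t := by
    funext c
    rw [prob, prob, PMF.map_id, productPMF_map_eval]
  rw [entropy_eq_sum, hmarg]
  exact (sum_prob_comp (productPMF q) id (fun a => a t) fun c =>
    -log (prob (productPMF q) (fun a => a t) c)).symm

lemma entropy_iid {Ω : Type*} [Fintype Ω] (P : PMF Ω) (A : Ω → β) :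
    entropy (productPMF fun _ : Fin n => P) (fun a t => A (a t)) = n * entropy P A := by
  have h := entropy_map (productPMF fun _ : Fin n => P) (fun a t => A (a t)) id
  rw [productPMF_map, entropy_productPMF] at h
  simpa [entropy_map] using h.symm

end ProductLaws

section Fano

variable {α : Type*} {N ε : ℝ}

/-- The law of a symbol in an alphabet of `N` letters which equals `c` up to the probability `ε` of
being redrawn uniformly. It is the reference law for Gibbs' inequality in the proof of Fano's
inequality. -/
def noisyLaw (N ε : ℝ) (c d : α) : ℝ := (if d = c then 1 - ε else 0) + ε / N

lemma noisyLaw_pos (hN : 0 < N) (h0 : 0 < ε) (h1 : ε < 1) (c d : α) : 0 < noisyLaw N ε c d := by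
  have := div_pos h0 hN
  unfold noisyLaw
  split_ifs <;> linarith

lemma sum_noisyLaw_le_one [Fintype α] (hα : (Fintype.card α : ℝ) ≤ N) (hN : 0 < N) (h0 : 0 ≤ ε)
    (c : α) : ∑ d, noisyLaw N ε c d ≤ 1 := by
  calc ∑ d, noisyLaw N ε c d = 1 - ε + Fintype.card α * (ε / N) := by
        simp [noisyLaw, Finset.sum_add_distrib]
    _ ≤ 1 - ε + N * (ε / N) := by gcongr
    _ = 1 := by rw [mul_div_cancel₀ _ hN.ne']; ring

lemma neg_log_noisyLaw_le (hN : 0 < N) (h0 : 0 ≤ ε) (h1 : ε < 1) (c d : α) :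
    -log (noisyLaw N ε c d) ≤ -log (1 - ε) + (if d ≠ c then 1 else 0) * log (N / ε) := by
  by_cases hcd : d = c
  · simpa [noisyLaw, hcd] using
      log_le_log (sub_pos.2 h1) (le_add_of_nonneg_right (div_nonneg h0 hN.le))
  · have : log (1 - ε) ≤ 0 := log_nonpos (by linarith) (by linarith)
    rw [noisyLaw, if_neg hcd, if_pos hcd, zero_add, one_mul, ← inv_div N ε, log_inv, neg_neg]
    linarith

/-- The upper bound, in nats per symbol, on the conditional entropy of a block in an alphabet of at
most `N` letters that can be estimated with average symbol error probability at most `ε`. -/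
def fanoBound (N ε : ℝ) : ℝ := -log (1 - ε) + ε * log (N / ε)

lemma tendsto_fanoBound (hN : 0 < N) {ε : ℕ → ℝ} (hpos : ∀ k, 0 < ε k)
    (hε : Tendsto ε atTop (𝓝 0)) : Tendsto (fun k => fanoBound N (ε k)) atTop (𝓝 0) := by
  have hcont : ContinuousAt (fun e : ℝ => -log (1 - e) + (e * log N + negMulLog e)) 0 :=
    ((ContinuousAt.log (by fun_prop) (by norm_num)).neg).add
      (ContinuousAt.add (by fun_prop) continuous_negMulLog.continuousAt)
  have hlim := hcont.tendsto.comp hε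
  simp only [sub_zero, log_one, neg_zero, zero_mul, negMulLog_zero, add_zero] at hlim
  refine hlim.congr fun k => ?_
  simp only [comp_apply, fanoBound, log_div hN.ne' (hpos k).ne', negMulLog]
  ring

lemma condEntropy_le_fanoBound {Ω β : Type*} [Fintype α] [Fintype β] {m : ℕ}
    (P : PMF Ω) (a : Ω → Fin m → α) (b : Ω → β) (g : β → Fin m → α) (hα : (Fintype.card α : ℝ) ≤ N)
    (hN : 1 ≤ N) (h0 : 0 < ε) (h1 : ε < 1)
    (herr : ∑ t, ∑ z, prob P (pair a b) z * (if z.1 t ≠ g z.2 t then 1 else 0) ≤ m * ε) :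
    condEntropy P a b ≤ m * fanoBound N ε := by
  have hNpos : 0 < N := one_pos.trans_le hN
  have hpos (c d : α) : 0 < noisyLaw N ε c d := noisyLaw_pos hNpos h0 h1 c d
  have hsum (c : α) := sum_noisyLaw_le_one hα hNpos h0.le c
  calc condEntropy P a b
      ≤ ∑ z, prob P (pair a b) z * -log (∏ t, noisyLaw N ε (g z.2 t) (z.1 t)) := by
        refine condEntropy_le_crossEntropy P a b (fun b a => ∏ t, noisyLaw N ε (g b t) (a t))
          (fun b a => Finset.prod_nonneg fun t _ => (hpos _ _).le) (fun b => ?_)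
          fun a b h => absurd h (Finset.prod_pos fun t _ => hpos _ _).ne'
        rw [← Fintype.prod_sum fun t d => noisyLaw N ε (g b t) d]
        exact Finset.prod_le_one (fun t _ => Finset.sum_nonneg fun d _ => (hpos _ _).le)
          fun t _ => hsum _
    _ ≤ ∑ z, prob P (pair a b) z *
          ∑ t, (-log (1 - ε) + (if z.1 t ≠ g z.2 t then 1 else 0) * log (N / ε)) := by
        refine Finset.sum_le_sum fun z _ => mul_le_mul_of_nonneg_left ?_ (prob_nonneg _ _ _)
        rw [log_prod fun t _ => (hpos _ _).ne', ← Finset.sum_neg_distrib]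
        exact Finset.sum_le_sum fun t _ => neg_log_noisyLaw_le hNpos h0.le h1 _ _
    _ = m * (-log (1 - ε)) + (∑ t, ∑ z, prob P (pair a b) z *
          (if z.1 t ≠ g z.2 t then 1 else 0)) * log (N / ε) := by
        rw [Finset.sum_comm (γ := Fin m)]
        simp only [Finset.sum_add_distrib, mul_add, Finset.sum_const, Finset.card_univ,
          Fintype.card_fin, nsmul_eq_mul, ← Finset.sum_mul, sum_prob, one_mul, ← Finset.mul_sum,
          ← mul_assoc]
    _ ≤ m * (-log (1 - ε)) + m * ε * log (N / ε) := by
        have hlog : 0 ≤ log (N / ε) := log_nonneg (by rw [le_div_iff₀ h0]; linarith)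
        gcongr
    _ = m * fanoBound N ε := by rw [fanoBound]; ring

end Fano

section Code

variable {U S₁ S₂ X Y₁ Y₂ : Type*} [Fintype U] [Fintype S₁] [Fintype S₂] [Fintype Y₁] [Fintype Y₂]
  {m n : ℕ}

/-- The input block of the code `f` for the source block of `a`. -/
def codeInput (f : (Fin m → S₁) × (Fin m → S₂) → (Fin n → X)) (a : Fin m → U × S₁ × S₂) :
    Fin n → X :=
  f (fun t => (a t).2.1, fun t => (a t).2.2)

/-- The joint law of the block of `(U, S₁, S₂)` and of the output block of the code `f`. Unlike
`blockLaw` it carries the auxiliary variable `U`. -/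
def codeLaw (p : PMF (S₁ × S₂)) (W : X → PMF (Y₁ × Y₂)) (pU : S₁ × S₂ → PMF U)
    (f : (Fin m → S₁) × (Fin m → S₂) → (Fin n → X)) :
    PMF ((Fin m → U × S₁ × S₂) × (Fin n → Y₁ × Y₂)) :=
  (productPMF fun _ : Fin m => sourceJoint p pU).bind fun a =>
    (productPMF fun t : Fin n => W (codeInput f a t)).map (Prod.mk a)

variable (p : PMF (S₁ × S₂)) (W : X → PMF (Y₁ × Y₂)) (pU : S₁ × S₂ → PMF U)
  (f : (Fin m → S₁) × (Fin m → S₂) → (Fin n → X))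

lemma codeLaw_map_fst :
    (codeLaw p W pU f).map Prod.fst = productPMF fun _ : Fin m => sourceJoint p pU := by
  have hconst (a : Fin m → U × S₁ × S₂) :
      (productPMF fun t => W (codeInput f a t)).map (Prod.fst ∘ Prod.mk a) = PMF.pure a :=
    PMF.map_const _ a
  simp only [codeLaw, PMF.map_bind, PMF.map_comp, hconst, PMF.bind_pure]

lemma productPMF_sourceJoint_map :
    (productPMF fun _ : Fin m => sourceJoint p pU).map (fun a t => (a t).2) =
      productPMF fun _ => p := by
  rw [productPMF_map]
  exact congrArg productPMF (funext fun _ => inputLaw_map_snd p pU)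

lemma codeLaw_map_eq_blockLaw :
    (codeLaw p W pU f).map (fun ω => (fun t => (ω.1 t).2, ω.2)) = blockLaw p W f := by
  rw [codeLaw, PMF.map_bind, blockLaw, ← productPMF_sourceJoint_map p pU, PMF.bind_map]
  simp_rw [PMF.map_comp]
  rfl

lemma prob_codeInput (t : Fin n) : prob (codeLaw p W pU f) (fun ω => codeInput f ω.1 t) =
    prob (productPMF fun _ : Fin m => p) fun s => f (fun t => (s t).1, fun t => (s t).2) t := by
  funext x
  rw [← productPMF_sourceJoint_map p pU, prob_map, ← codeLaw_map_fst p W pU f, prob_map]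
  rfl

lemma isMarkov_codeLaw {V : Type*} {t : Fin n} {v : (Fin m → U × S₁ × S₂) × (Fin n → Y₁ × Y₂) → V}
    (hv : ∀ a y c, v (a, update y t c) = v (a, y)) :
    IsMarkov (codeLaw p W pU f) v (fun ω => codeInput f ω.1 t) (fun ω => ω.2 t) W := by
  have hlaw : codeLaw p W pU f =
      ((codeLaw p W pU f).bind fun ω => (W (codeInput f ω.1 t)).map (Prod.mk ω)).map
        fun z => (z.1.1, update z.1.2 t z.2) := by
    conv_lhs => rw [codeLaw]
    simp only [codeLaw, PMF.bind_bind, PMF.bind_map, PMF.map_bind]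
    congr 1
    funext a
    conv_lhs => rw [productPMF_eq_bind_update _ t, PMF.map_bind]
    simp only [PMF.map_comp, comp_apply]
    rfl
  have hout : (fun ω : (Fin m → U × S₁ × S₂) × (Fin n → Y₁ × Y₂) => ω.2 t) ∘
      (fun z : ((Fin m → U × S₁ × S₂) × (Fin n → Y₁ × Y₂)) × Y₁ × Y₂ =>
        (z.1.1, update z.1.2 t z.2)) = Prod.snd :=
    funext fun _ => by simp
  rw [hlaw, isMarkov_map_iff, hout]
  refine (isMarkov_bind_map (codeLaw p W pU f) (fun ω => codeInput f ω.1 t) W).of_factorsThrough ?_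
  rintro ⟨ω, c⟩ ⟨_, c'⟩ rfl
  exact (hv ω.1 ω.2 c).trans (hv ω.1 ω.2 c').symm

/-- The block with entries `A (U(t), S₁(t), S₂(t))`. -/
def sourceBlock {α β γ : Type*} (A : α → β) : (Fin m → α) × γ → Fin m → β := fun ω t => A (ω.1 t)

/-- The output symbol `B (Y₁(t), Y₂(t))` at each time `t`. -/
def outputSymbol {α β γ : Type*} (B : α → β) (t : Fin n) : γ × (Fin n → α) → β := fun ω => B (ω.2 t)

lemma isMarkov_codeLaw_blockGap (t : Fin n) :
    IsMarkov (codeLaw p W pU f)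
      (pair Prod.fst (blockGap (outputSymbol Prod.fst) (outputSymbol Prod.snd) t))
      (fun ω => codeInput f ω.1 t) (fun ω => ω.2 t) W := by
  refine isMarkov_codeLaw p W pU f fun a y c => Prod.ext rfl (blockGap_eq_iff.2 ⟨?_, ?_⟩)
  · exact fun i hi => congrArg Prod.fst (update_of_ne hi.ne c y)
  · exact fun i hi => congrArg Prod.snd (update_of_ne hi.ne' c y)

lemma entropy_codeLaw {α : Type*} [Fintype α] (A : U × S₁ × S₂ → α) :
    entropy (codeLaw p W pU f) (sourceBlock A) = m * entropy (sourceJoint p pU) A := by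
  rw [← entropy_iid, ← codeLaw_map_fst p W pU f, entropy_map]
  rfl

lemma condEntropy_codeLaw {α β : Type*} [Fintype α] [Fintype β] (A : U × S₁ × S₂ → α)
    (B : U × S₁ × S₂ → β) :
    condEntropy (codeLaw p W pU f) (sourceBlock A) (sourceBlock B) =
      m * condEntropy (sourceJoint p pU) A B := by
  have hpair : entropy (codeLaw p W pU f) (pair (sourceBlock A) (sourceBlock B)) =
      entropy (codeLaw p W pU f) (sourceBlock (pair A B)) :=
    entropy_congr _ fun ω ω' => by simp [pair, sourceBlock, funext_iff, forall_and]
  rw [condEntropy_eq, condEntropy_eq, hpair, entropy_codeLaw, entropy_codeLaw, mul_sub]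

lemma sourceEntropies_codeLaw :
    sourceEntropies (codeLaw p W pU f) (sourceBlock fun a => a.1) (sourceBlock fun a => a.2.1)
      (sourceBlock fun a => a.2.2) = (m : ℝ) • sourcePoint p (inputArray p pU) := by
  have hpair : condEntropy (codeLaw p W pU f) (pair (sourceBlock fun a => a.2.1)
      (sourceBlock fun a => a.2.2)) (sourceBlock fun a => a.1) =
      condEntropy (codeLaw p W pU f) (sourceBlock (pair (fun a => a.2.1) fun a => a.2.2))
        (sourceBlock fun a => a.1) :=
    condEntropy_congr _
      (fun ω ω' => by simp [pair, sourceBlock, funext_iff, forall_and, Prod.ext_iff])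
      fun _ _ => Iff.rfl
  rw [← sourceEntropies_sourceJoint]
  simp only [sourceEntropies, hpair, entropy_codeLaw, condEntropy_codeLaw, Prod.smul_mk,
    smul_eq_mul]

lemma toReal_toOuterMeasure_preimage {Ω α : Type*} [Fintype α] (P : PMF Ω) (A : Ω → α)
    (s : Set α) :
    (P.toOuterMeasure (A ⁻¹' s)).toReal = ∑ a, prob P A a * if a ∈ s then 1 else 0 := by
  rw [← PMF.toOuterMeasure_map_apply, PMF.toOuterMeasure_apply_fintype,
    ENNReal.toReal_sum fun a _ => ((Set.indicator_le_self s _ a).trans_lt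
      ((P.map A).apply_lt_top a)).ne]
  refine Finset.sum_congr rfl fun a _ => ?_
  by_cases ha : a ∈ s <;> simp [ha, prob]

lemma toReal_blockLaw_error {α β : Type*} [Fintype α] [Fintype β] (A : S₁ × S₂ → α)
    (B : Y₁ × Y₂ → β) (g : (Fin n → β) → Fin m → α) (t : Fin m) :
    ((blockLaw p W f).toOuterMeasure {ω | A (ω.1 t) ≠ g (fun q => B (ω.2 q)) t}).toReal =
      ∑ z, prob (codeLaw p W pU f) (pair (sourceBlock fun a => A a.2) (block (outputSymbol B))) z *
        if z.1 t ≠ g z.2 t then 1 else 0 := by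
  rw [← codeLaw_map_eq_blockLaw p W pU f, PMF.toOuterMeasure_map_apply]
  refine (toReal_toOuterMeasure_preimage (codeLaw p W pU f)
    (pair (sourceBlock fun a => A a.2) (block (outputSymbol B))) {z | z.1 t ≠ g z.2 t}).trans ?_
  exact Finset.sum_congr rfl fun z _ => by by_cases h : z.1 t = g z.2 t <;> simp [h]

end Code

section TimeSharing

variable {X Y₁ Y₂ : Type*} [Fintype X] [Fintype Y₁] [Fintype Y₂]

lemma exists_test_of_average (W : X → PMF (Y₁ × Y₂)) {n : ℕ} (hn : 0 < n)
    {q : Fin n → X → ℝ} (hq : ∀ t, q t ∈ stdSimplex ℝ X) :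
    ∃ pX : PMF X, ∀ z : Fin n → (ℝ × ℝ) × (ℝ × ℝ) × (ℝ × ℝ),
      (∀ t, (q t, z t) ∈ PointedCone.hull ℝ (atoms (outEntropies W))) →
        ∃ pV : X → PMF (Fin (Fintype.card X + 5) × Fin (Fintype.card X) × Fin (Fintype.card X)),
          ∑ t, pointSide W (q t, z t) ≤
            (n : ℝ) • pointSide W (arrayPoint (outEntropies W) (inputArray pX pV)) := by
  have hn' : (0 : ℝ) < n := by exact_mod_cast hn
  have hweight (t : Fin n) (_ : t ∈ Finset.univ) : 0 ≤ (n : ℝ)⁻¹ := (inv_pos.2 hn').le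
  have hweights : ∑ _t : Fin n, (n : ℝ)⁻¹ = 1 := by simp [hn'.ne']
  obtain ⟨pX, hpX⟩ := exists_pmf_of_mem_stdSimplex
    ((convex_stdSimplex ℝ X).sum_mem hweight hweights fun t _ => hq t)
  refine ⟨pX, fun z hz => ?_⟩
  have haverage : ∑ t, (n : ℝ)⁻¹ • (q t, z t) =
      (fun x => (pX x).toReal, ∑ t, (n : ℝ)⁻¹ • z t) := by
    rw [funext hpX]
    simp only [Prod.ext_iff, Prod.fst_sum, Prod.snd_sum, Prod.smul_mk, and_self]
  have hmem : ∑ t, (n : ℝ)⁻¹ • (q t, z t) ∈ PointedCone.hull ℝ (atoms (outEntropies W)) :=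
    (PointedCone.convex _).sum_mem hweight hweights fun t _ => hz t
  rw [haverage] at hmem
  obtain ⟨pV, hpV⟩ := exists_test_of_mem_hull_atoms W pX hmem
  refine ⟨pV, ?_⟩
  calc
    ∑ t, pointSide W (q t, z t) = (n : ℝ) • ∑ t, (n : ℝ)⁻¹ • pointSide W (q t, z t) := by
      rw [← Finset.smul_sum, smul_inv_smul₀ hn'.ne']
    _ ≤ (n : ℝ) • pointSide W (∑ t, (n : ℝ)⁻¹ • (q t, z t)) :=
      smul_le_smul_of_nonneg_left
        ((concaveOn_pointSide W).le_map_sum hweight hweights fun t _ => ⟨hq t, trivial⟩) hn'.le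
    _ ≤ _ := smul_le_smul_of_nonneg_left (haverage ▸ hpV) hn'.le

end TimeSharing

section CodeBound

lemma IsMarkov.condEntropy_pair_input_le {Ω V V' X Y : Type*} [Fintype V] [Fintype V']
    [Fintype X] [Fintype Y] {P : PMF Ω} {v : Ω → V} {v' : Ω → V'} {x : Ω → X} {y : Ω → Y}
    {W : X → PMF Y} (h : IsMarkov P v x y W) (h' : IsMarkov P v' x y W) :
    condEntropy P y (pair v' x) ≤ condEntropy P y v := by
  rw [h'.condEntropy_pair_input, ← h.condEntropy_pair_input]
  exact condEntropy_mono P y fun _ _ hω => (Prod.mk.inj hω).1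

variable {U S₁ S₂ X Y₁ Y₂ : Type*} [Fintype U] [Fintype S₁] [Fintype S₂] [Fintype X] [Fintype Y₁]
  [Fintype Y₂] {m n : ℕ}

/-- The variables `(V₀, V₁, V₂)` that a code induces at time `t`: `V₁` and `V₂` are the two source
blocks, and `V₀` consists of the block of `U`, the first outputs before `t` and the second outputs
after `t`. -/
def codeTest (t : Fin n) : (Fin m → U × S₁ × S₂) × (Fin n → Y₁ × Y₂) →
    ((Fin m → U) × (Fin n → Option Y₁) × (Fin n → Option Y₂)) × (Fin m → S₁) × (Fin m → S₂) :=
  pair (pair (sourceBlock fun a => a.1)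
      (blockGap (outputSymbol Prod.fst) (outputSymbol Prod.snd) t))
    (pair (sourceBlock fun a => a.2.1) (sourceBlock fun a => a.2.2))

variable (p : PMF (S₁ × S₂)) (W : X → PMF (Y₁ × Y₂))
  (f : (Fin m → S₁) × (Fin m → S₂) → (Fin n → X))

omit [Fintype X] in
lemma isMarkov_codeTest (pU : S₁ × S₂ → PMF U) (t : Fin n) :
    IsMarkov (codeLaw p W pU f) (codeTest t) (fun ω => codeInput f ω.1 t)
      (pair (outputSymbol Prod.fst t) (outputSymbol Prod.snd t)) W :=
  (isMarkov_codeLaw_blockGap p W pU f t).comp fun z _ =>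
    (((fun s => (z.1 s).1), z.2), (fun s => (z.1 s).2.1), (fun s => (z.1 s).2.2))

/-- The joint weights of `codeTest t` and the channel input at time `t`. -/
def codeArray (pU : S₁ × S₂ → PMF U) (t : Fin n) :
    ((Fin m → U) × (Fin n → Option Y₁) × (Fin n → Option Y₂)) × (Fin m → S₁) × (Fin m → S₂) →
      X → ℝ :=
  jointArray (codeLaw p W pU f) (codeTest t) fun ω => codeInput f ω.1 t

lemma arrayPoint_codeArray_fst (pU : S₁ × S₂ → PMF U) (t : Fin n) :
    (arrayPoint (outEntropies W) (codeArray p W f pU t)).1 =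
      prob (productPMF fun _ : Fin m => p) fun s => f (fun t => (s t).1, fun t => (s t).2) t :=
  (congrArg Prod.fst (isMarkov_codeTest p W f pU t).arrayPoint_jointArray).trans
    (prob_codeInput p W pU f t)

lemma channelSide_codeLaw_le (pU : S₁ × S₂ → PMF U) :
    channelSide (channelEntropies (codeLaw p W pU f) (sourceBlock fun a => a.1)
      (sourceBlock fun a => a.2.1) (sourceBlock fun a => a.2.2)
      (pair (sourceBlock fun a => a.2.1) (sourceBlock fun a => a.2.2))
      (block (outputSymbol Prod.fst)) (block (outputSymbol Prod.snd))) ≤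
    ∑ t, pointSide W (arrayPoint (outEntropies W) (codeArray p W f pU t)) := by
  have hout₁ (t : Fin n) : IsMarkov (codeLaw p W pU f) (codeTest t) (fun ω => codeInput f ω.1 t)
      (outputSymbol Prod.fst t) (outputMap W Prod.fst) :=
    (isMarkov_codeTest p W f pU t).comp_output Prod.fst
  have hout₂ (t : Fin n) : IsMarkov (codeLaw p W pU f) (codeTest t) (fun ω => codeInput f ω.1 t)
      (outputSymbol Prod.snd t) (outputMap W Prod.snd) :=
    (isMarkov_codeTest p W f pU t).comp_output Prod.snd
  have hblock := channelSide_block_le (codeLaw p W pU f) (sourceBlock fun a => a.1)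
    (sourceBlock fun a => a.2.1) (sourceBlock fun a => a.2.2) (fun t ω => codeInput f ω.1 t)
    (outputSymbol Prod.fst) (outputSymbol Prod.snd)
    (fun t => ((hout₁ t).comp fun z _ => (((z.1.1, z.2.2), z.2), z.1.2)).condEntropy_pair_input_le
      ((hout₁ t).comp fun z _ => (z.1, z.2.2)))
    fun t => ((hout₂ t).comp fun z _ => (((z.1.1, z.2.1), z.2), z.1.2)).condEntropy_pair_input_le
      ((hout₂ t).comp fun z _ => (z.1, z.2.1))
  exact hblock.trans_eq (Finset.sum_congr rfl fun t _ =>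
    (isMarkov_codeTest p W f pU t).channelSide_eq_pointSide)

lemma exists_test_of_codeLaw [Nonempty X] :
    ∃ pX : PMF X, ∀ (U : Type w) [Fintype U] (pU : S₁ × S₂ → PMF U),
      ∃ pV : X → PMF (Fin (Fintype.card X + 5) × Fin (Fintype.card X) × Fin (Fintype.card X)),
        ∑ t, pointSide W (arrayPoint (outEntropies W) (codeArray p W f pU t)) ≤
          (n : ℝ) • pointSide W (arrayPoint (outEntropies W) (inputArray pX pV)) := by
  rcases n.eq_zero_or_pos with rfl | hn
  · have : NeZero (Fintype.card X) := ⟨Fintype.card_ne_zero⟩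
    exact ⟨PMF.pure (Classical.arbitrary X), fun U _ pU => ⟨fun _ => PMF.pure 0, by simp⟩⟩
  obtain ⟨pX, hpX⟩ := exists_test_of_average W hn
    (q := fun t => prob (productPMF fun _ : Fin m => p)
      fun s => f (fun t => (s t).1, fun t => (s t).2) t)
    fun t => ⟨fun x => prob_nonneg _ _ _, sum_prob _ _⟩
  refine ⟨pX, fun U _ pU => ?_⟩
  have hpoint (t : Fin n) : (prob (productPMF fun _ : Fin m => p)
      (fun s => f (fun t => (s t).1, fun t => (s t).2) t),
        (arrayPoint (outEntropies W) (codeArray p W f pU t)).2) =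
      arrayPoint (outEntropies W) (codeArray p W f pU t) :=
    Prod.ext (arrayPoint_codeArray_fst p W f pU t).symm rfl
  obtain ⟨pV, hpV⟩ := hpX (fun t => (arrayPoint (outEntropies W) (codeArray p W f pU t)).2)
    fun t => (hpoint t).symm ▸
      arrayPoint_mem_hull_atoms (posHomogeneous_outEntropies W) (jointArray_nonneg _ _ _)
  exact ⟨pV, by simpa only [hpoint] using hpV⟩

variable {g₁ : (Fin n → Y₁) → (Fin m → S₁)} {g₂ : (Fin n → Y₂) → (Fin m → S₂)} {N ε : ℝ}

lemma sourceSide_le_of_code (hN : 1 ≤ N) (hN₁ : Fintype.card S₁ ≤ N) (hN₂ : Fintype.card S₂ ≤ N)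
    (h0 : 0 < ε) (h1 : ε < 1)
    (herr₁ : ∑ t : Fin m, ((blockLaw p W f).toOuterMeasure
      {ω | (ω.1 t).1 ≠ g₁ (fun q => (ω.2 q).1) t}).toReal ≤ m * ε)
    (herr₂ : ∑ t : Fin m, ((blockLaw p W f).toOuterMeasure
      {ω | (ω.1 t).2 ≠ g₂ (fun q => (ω.2 q).2) t}).toReal ≤ m * ε) (pU : S₁ × S₂ → PMF U) :
    (m : ℝ) • sourceSide (sourcePoint p (inputArray p pU)) ≤
      ∑ t, pointSide W (arrayPoint (outEntropies W) (codeArray p W f pU t)) +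
        (3 * (m * fanoBound N ε)) • 1 := by
  simp only [toReal_blockLaw_error p W pU f Prod.fst Prod.fst g₁] at herr₁
  simp only [toReal_blockLaw_error p W pU f Prod.snd Prod.snd g₂] at herr₂
  have hfano₁ := condEntropy_le_fanoBound _ _ _ g₁ hN₁ hN h0 h1 herr₁
  have hfano₂ := condEntropy_le_fanoBound _ _ _ g₂ hN₂ hN h0 h1 herr₂
  rw [← map_smul, ← sourceEntropies_codeLaw p W pU f]
  exact (sourceSide_le_channelSide_add _ _ _ _ _ _ hfano₁ hfano₂).trans
    (add_le_add_left (channelSide_codeLaw_le p W f pU) _)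

lemma exists_test_of_code [Nonempty X] (hN : 1 ≤ N) (hN₁ : Fintype.card S₁ ≤ N)
    (hN₂ : Fintype.card S₂ ≤ N) (h0 : 0 < ε) (h1 : ε < 1)
    (herr₁ : ∑ t : Fin m, ((blockLaw p W f).toOuterMeasure
      {ω | (ω.1 t).1 ≠ g₁ (fun q => (ω.2 q).1) t}).toReal ≤ m * ε)
    (herr₂ : ∑ t : Fin m, ((blockLaw p W f).toOuterMeasure
      {ω | (ω.1 t).2 ≠ g₂ (fun q => (ω.2 q).2) t}).toReal ≤ m * ε) :
    ∃ pX : PMF X, ∀ (U : Type w) [Fintype U] (pU : S₁ × S₂ → PMF U),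
      ∃ pV : X → PMF (Fin (Fintype.card X + 5) × Fin (Fintype.card X) × Fin (Fintype.card X)),
        (m : ℝ) • sourceSide (sourcePoint p (inputArray p pU)) ≤
          (n : ℝ) • pointSide W (arrayPoint (outEntropies W) (inputArray pX pV)) +
            (3 * (m * fanoBound N ε)) • 1 := by
  obtain ⟨pX, hpX⟩ := exists_test_of_codeLaw p W f
  refine ⟨pX, fun U _ pU => ?_⟩
  obtain ⟨pV, hpV⟩ := hpX U pU
  exact ⟨pV, (sourceSide_le_of_code p W f hN hN₁ hN₂ h0 h1 herr₁ herr₂ pU).trans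
    (add_le_add_left hpV _)⟩

end CodeBound

section Limit

variable {S₁ S₂ V X Y₁ Y₂ : Type*} [Fintype S₁] [Fintype S₂] [Fintype V] [Fintype X] [Fintype Y₁]
  [Fintype Y₂]

lemma exists_tendsto_toReal_subseq (P : ℕ → PMF X) :
    ∃ (Q : PMF X) (φ : ℕ → ℕ), StrictMono φ ∧
      Tendsto (fun k x => (P (φ k) x).toReal) atTop (𝓝 fun x => (Q x).toReal) := by
  obtain ⟨q, hq, φ, hφ, hlim⟩ := (isCompact_stdSimplex ℝ X).tendsto_subseq
    fun k => toReal_mem_stdSimplex (P k)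
  obtain ⟨Q, hQ⟩ := exists_pmf_of_mem_stdSimplex hq
  exact ⟨Q, φ, hφ, funext hQ ▸ hlim⟩

lemma exists_tendsto_inputArray_subseq {pXs : ℕ → PMF X} {pX : PMF X}
    (hX : Tendsto (fun k x => (pXs k x).toReal) atTop (𝓝 fun x => (pX x).toReal))
    (pVs : ℕ → X → PMF V) :
    ∃ (pV : X → PMF V) (φ : ℕ → ℕ), StrictMono φ ∧
      Tendsto (fun k => inputArray (pXs (φ k)) (pVs (φ k))) atTop (𝓝 (inputArray pX pV)) := by
  have hmem (k : ℕ) : inputArray (pXs k) (pVs k) ∈ Set.Icc 0 1 :=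
    ⟨inputArray_nonneg _ _, fun v x => mul_le_one₀ (ENNReal.toReal_mono ENNReal.one_ne_top
      ((pXs k).coe_le_one x)) ENNReal.toReal_nonneg
        (ENNReal.toReal_mono ENNReal.one_ne_top ((pVs k x).coe_le_one v))⟩
  obtain ⟨r, hr, φ, hφ, hlim⟩ := isCompact_Icc.tendsto_subseq hmem
  have hsum : Tendsto (fun k => ∑ v, inputArray (pXs (φ k)) (pVs (φ k)) v) atTop (𝓝 (∑ v, r v)) :=
    tendsto_finsetSum _ fun v _ => tendsto_pi_nhds.1 hlim v
  simp only [sum_inputArray] at hsum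
  obtain ⟨pV, hpV⟩ := exists_inputArray_eq (pX := pX) hr.1
    (tendsto_nhds_unique hsum (hX.comp hφ.tendsto_atTop))
  exact ⟨pV, φ, hφ, hpV ▸ hlim⟩

variable {p : PMF (S₁ × S₂)} {W : X → PMF (Y₁ × Y₂)} {κ : ℝ}

lemma Admissible.exists_test_add_fanoBound [Nonempty X] (h : Admissible p W κ) {N ε : ℝ}
    (hN : 1 ≤ N) (hN₁ : Fintype.card S₁ ≤ N) (hN₂ : Fintype.card S₂ ≤ N) (h0 : 0 < ε)
    (h1 : ε < 1) :
    ∃ pX : PMF X, ∀ (U : Type w) [Fintype U] (pU : S₁ × S₂ → PMF U),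
      ∃ pV : X → PMF (Fin (Fintype.card X + 5) × Fin (Fintype.card X) × Fin (Fintype.card X)),
        sourceSide (sourcePoint p (inputArray p pU)) ≤
          (κ + ε) • pointSide W (arrayPoint (outEntropies W) (inputArray pX pV)) +
            (3 * fanoBound N ε) • 1 := by
  obtain ⟨m, n, f, g₁, g₂, hm, hrate, herr₁, herr₂⟩ := h ε h0
  have hm' : (0 : ℝ) < m := by exact_mod_cast hm
  rw [one_div, inv_mul_le_iff₀ hm'] at herr₁ herr₂
  obtain ⟨pX, hpX⟩ := exists_test_of_code.{w} p W f hN hN₁ hN₂ h0 h1 herr₁ herr₂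
  refine ⟨pX, fun U _ pU => ?_⟩
  obtain ⟨pV, hpV⟩ := hpX U pU
  refine ⟨pV, ?_⟩
  calc
    sourceSide (sourcePoint p (inputArray p pU)) ≤
        (m : ℝ)⁻¹ • ((n : ℝ) • pointSide W (arrayPoint (outEntropies W) (inputArray pX pV)) +
          (3 * (m * fanoBound N ε)) • 1) := (le_inv_smul_iff_of_pos hm').2 hpV
    _ = ((n : ℝ) / m) • pointSide W (arrayPoint (outEntropies W) (inputArray pX pV)) +
          (3 * fanoBound N ε) • 1 := by
      rw [smul_add, smul_smul, smul_smul]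
      congr 2 <;> field_simp
    _ ≤ _ := add_le_add_left
      (smul_le_smul_of_nonneg_right hrate (pointSide_inputArray_nonneg W pX pV)) _

theorem Admissible.exists_test [Nonempty X] (h : Admissible p W κ) :
    ∃ pX : PMF X, ∀ (U : Type w) [Fintype U] (pU : S₁ × S₂ → PMF U),
      ∃ pV : X → PMF (Fin (Fintype.card X + 5) × Fin (Fintype.card X) × Fin (Fintype.card X)),
        BoundHolds κ p W pX pU pV := by
  obtain ⟨ε, -, hε, hlim⟩ := exists_seq_strictAnti_tendsto' (one_pos (α := ℝ))
  let N : ℝ := Fintype.card S₁ + Fintype.card S₂ + 1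
  have hN : 1 ≤ N := le_add_of_nonneg_left (by positivity)
  have hN₁ : Fintype.card S₁ ≤ N := by linarith [(Fintype.card S₂).cast_nonneg (α := ℝ)]
  have hN₂ : Fintype.card S₂ ≤ N := by linarith [(Fintype.card S₁).cast_nonneg (α := ℝ)]
  choose pXs hpXs using fun k =>
    h.exists_test_add_fanoBound.{w} hN hN₁ hN₂ (hε k).1 (hε k).2
  obtain ⟨pX, φ, hφ, hX⟩ := exists_tendsto_toReal_subseq pXs
  refine ⟨pX, fun U _ pU => ?_⟩
  choose pVs hpVs using fun k => hpXs (φ k) U pU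
  obtain ⟨pV, ψ, hψ, hV⟩ := exists_tendsto_inputArray_subseq hX pVs
  refine ⟨pV, (boundHolds_iff κ p W pX pU pV).2 ?_⟩
  have hεφψ : Tendsto (fun k => ε (φ (ψ k))) atTop (𝓝 0) :=
    hlim.comp (hφ.comp hψ).tendsto_atTop
  have hpoint := (((continuous_pointSide W).comp
    (continuous_arrayPoint (continuous_outEntropies W))).tendsto _).comp hV
  have hfano := tendsto_fanoBound (one_pos.trans_le hN) (fun k => (hε (φ (ψ k))).1) hεφψ
  have hbound := ((hεφψ.const_add κ).smul hpoint).add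
    ((hfano.const_mul 3).smul_const (1 : Fin 10 → ℝ))
  rw [add_zero, mul_zero, zero_smul, add_zero] at hbound
  exact ge_of_tendsto' hbound fun k => hpVs (ψ k)

end Limit

end BroadcastSource

end

theorem theorem3_general {S₁ S₂ X Y₁ Y₂ : Type*}
    [Fintype S₁] [Fintype S₂] [Fintype X] [Nonempty X] [Fintype Y₁] [Fintype Y₂]
    (p : PMF (S₁ × S₂)) (W : X → PMF (Y₁ × Y₂)) (κ : ℝ) (hκ : 0 ≤ κ) :
    (Admissible p W κ →
      ∃ pX : PMF X, ∀ (U : Type w) [Fintype U] (pU : S₁ × S₂ → PMF U),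
        ∃ pV : X → PMF (Fin (Fintype.card X + 5) × Fin (Fintype.card X) × Fin (Fintype.card X)),
          BoundHolds κ p W pX pU pV) ∧
    (∀ pX : PMF X,
      (∀ (U : Type w) [Fintype U], Fintype.card U ≤ Fintype.card S₁ * Fintype.card S₂ →
        ∀ pU : S₁ × S₂ → PMF U,
          ∃ (V₀ V₁ V₂ : Type w) (_ : Fintype V₀) (_ : Fintype V₁) (_ : Fintype V₂)
            (pV : X → PMF (V₀ × V₁ × V₂)), BoundHolds κ p W pX pU pV) →
      ∀ (U : Type w) [Fintype U] (pU : S₁ × S₂ → PMF U),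
        ∃ pV : X → PMF (Fin (Fintype.card X + 5) × Fin (Fintype.card X) × Fin (Fintype.card X)),
          BoundHolds κ p W pX pU pV) ∧
    (∀ (T : Type w) [Fintype T] (φ₁ : S₁ → T) (φ₂ : S₂ → T),
      (∀ s ∈ p.support, φ₁ s.1 = φ₂ s.2) →
      ∀ (V₀ V₁ V₂ : Type w) [Fintype V₀] [Fintype V₁] [Fintype V₂]
        (pX : PMF X) (pV : X → PMF (V₀ × V₁ × V₂)),
        BoundHolds κ p W pX (fun s => PMF.pure (φ₁ s.1)) pV ↔
          GohariAnantharamHolds κ p W pX φ₁ pV) :=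
  ⟨Admissible.exists_test, fun pX h _ _ pU => exists_bounded_test p W hκ pX h pU,
    fun _ _ _ _ h _ _ _ _ _ _ pX pV => boundHolds_iff_gohariAnantharamHolds p W hκ h pX pV⟩

theorem theorem3 {S₁ S₂ X Y₁ Y₂ : Type*}
    [Fintype S₁] [Fintype S₂] [Fintype X] [Nonempty X] [Fintype Y₁] [Fintype Y₂]
    (p : PMF (S₁ × S₂)) (W : X → PMF (Y₁ × Y₂)) (κ : ℝ) (hκ : 0 ≤ κ) :
    -- the outer bound, with bounded alphabets for `V₀`, `V₁`, `V₂`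
    (Admissible p W κ →
      ∃ pX : PMF X, ∀ (U : Type w) [Fintype U] (pU : S₁ × S₂ → PMF U),
        ∃ pV : X → PMF (Fin (Fintype.card X + 5) × Fin (Fintype.card X) × Fin (Fintype.card X)),
          BoundHolds κ p W pX pU pV) ∧
    -- for each input distribution it suffices to consider `|U| ≤ |S₁| |S₂|`, `|V₀| ≤ |X| + 5` and
    -- `|V₁|, |V₂| ≤ |X|`
    (∀ pX : PMF X,
      (∀ (U : Type w) [Fintype U], Fintype.card U ≤ Fintype.card S₁ * Fintype.card S₂ →
        ∀ pU : S₁ × S₂ → PMF U,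
          ∃ (V₀ V₁ V₂ : Type w) (_ : Fintype V₀) (_ : Fintype V₁) (_ : Fintype V₂)
            (pV : X → PMF (V₀ × V₁ × V₂)), BoundHolds κ p W pX pU pV) →
      ∀ (U : Type w) [Fintype U] (pU : S₁ × S₂ → PMF U),
        ∃ pV : X → PMF (Fin (Fintype.card X + 5) × Fin (Fintype.card X) × Fin (Fintype.card X)),
          BoundHolds κ p W pX pU pV) ∧
    -- the choice `U = S₀` recovers the Gohari–Anantharam inequalities
    (∀ (T : Type w) [Fintype T] (φ₁ : S₁ → T) (φ₂ : S₂ → T), IsCommonPart p φ₁ φ₂ →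
      ∀ (V₀ V₁ V₂ : Type w) [Fintype V₀] [Fintype V₁] [Fintype V₂]
        (pX : PMF X) (pV : X → PMF (V₀ × V₁ × V₂)),
        BoundHolds κ p W pX (fun s => PMF.pure (φ₁ s.1)) pV ↔
          GohariAnantharamHolds κ p W pX φ₁ pV) :=
  let ⟨h₁, h₂, h₃⟩ := theorem3_general p W κ hκ
  ⟨h₁, h₂, fun T _ φ₁ φ₂ h => h₃ T φ₁ φ₂ h.agree⟩
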